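/- Work in $\mathsf{ZF}$ (no choice); equivalently, the following holds inside every model of $\mathsf{ZF}$. Cardinals are initial ordinals, and $\lambda^+$ is the least cardinal above $\lambda$. An uncountable cardinal $\kappa$ is *weakly Löwenheim–Skolem* (weakly LS) if for all $\gamma<\kappa\le\alpha$ and $x\in V_\alpha$ there is an elementary submodel $X\prec V_\alpha$ such that $V_\gamma\subseteq X$, $x\in X$, and the transitive collapse of $X$ belongs to $V_\kappa$. The club filter over $\lambda^+$ consists of the subsets of $\lambda^+$ that contain a closed unbounded set (a club); it is $\mu$-complete if the intersection of fewer than $\mu$ of its members is again a member. A function $f:\lambda^+\setminus\{0\}\to\lambda^+$ is regressive if $f(\xi)<\xi$ for all $\xi$ in its domain. **A.** Let $\kappa$ be a weakly LS cardinal. 1. For every $x\in V_\kappa$ there is no surjection from $x$ onto $\kappa$. Moreover, for every cardinal $\lambda\ge\kappa$: 2. For every $x\in V_\kappa$ there is no cofinal map from $x$ into $\lambda^+$; in particular $\operatorname{cf}(\lambda^+)\ge\kappa$. 3. If $x\in V_\kappa$ and $f$ is a function from $x$ into the club filter over $\lambda^+$, then $\bigcap f``x$ contains a club in $\lambda^+$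 (the empty intersection being $\lambda^+$). In particular the club filter over $\lambda^+$ is $\kappa$-complete. 4. For every regressive $f:\lambda^+\setminus\{0\}\to\lambda^+$ there is $\gamma<\lambda^+$ such that $\{\xi\in\lambda^+\setminus\{0\} : f(\xi)\le\gamma\}$ is stationary in $\lambda^+$. **B.** Let $\lambda$ be a singular weakly LS cardinal. 1. There is no cofinal map from $V_\lambda$ into $\lambda^+$. In particular $\lambda^+$ is regular. 2. If $f$ is a function from $V_\lambda$ into the club filter over $\lambda^+$, then $\bigcap f``V_\lambda$ contains a club in $\lambda^+$. In particular the club filter over $\lambda^+$ is $\lambda^+$-complete. 3. For every regressive $f:\lambda^+\setminus\{0\}\to\lambda^+$ there is $\gamma<\lambda^+$ such that $\{\xi\in\lambda^+\setminus\{0\} : f(\xi)=\gamma\}$ is stationary in $\lambda^+$. -/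

import Mathlib

namespace ChoicelessLS

/-! ### The language of set theory and models of ZF -/

/-- The only non-logical symbol of set theory: a binary relation symbol. -/
inductive MemRel : ℕ → Type
  | mem : MemRel 2

/-- The first-order language with one binary relation symbol. -/
def setLang : FirstOrder.Language.{0, 0} := ⟨fun _ => Empty, MemRel⟩



section

variable {M : Type*} [setLang.Structure M]

/-- `x` is an element of `y` in the sense of the structure `M`. -/
def Mem (x y : M) : Prop :=
  FirstOrder.Language.Structure.RelMap (L := setLang) (MemRel.mem : setLang.Relations 2) ![x, y]

infix:50 " ∈ₘ " => Mem

/-! Every predicate below that is about elements of `M` is (the meaning in `M` of) a formula of the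
language of set theory: its quantifiers range over `M` and its only atoms are `∈ₘ` and `=`. -/

def Subs (x y : M) : Prop := ∀ z, z ∈ₘ x → z ∈ₘ y

def IsEmptySet (x : M) : Prop := ∀ z, ¬ z ∈ₘ x

/-- `y = x ∪ {x}`. -/
def IsSucc (y x : M) : Prop := ∀ z, z ∈ₘ y ↔ z ∈ₘ x ∨ z = x

def IsInductive (w : M) : Prop :=
  (∃ e, IsEmptySet e ∧ e ∈ₘ w) ∧ ∀ x, x ∈ₘ w → ∃ y, IsSucc y x ∧ y ∈ₘ w

/-- `p = {a, b}`. -/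
def IsPair (p a b : M) : Prop := ∀ z, z ∈ₘ p ↔ z = a ∨ z = b

variable (M) in
/-- `M` is a model of first-order Zermelo-Fraenkel set theory, without choice. Separation and
replacement are the usual schemes: one instance for each first-order formula with parameters
from `M`. -/
structure IsZFModel : Prop where
  extensionality : ∀ x y : M, (∀ z, z ∈ₘ x ↔ z ∈ₘ y) → x = y
  foundation : ∀ x : M, (∃ y, y ∈ₘ x) → ∃ y, y ∈ₘ x ∧ ∀ z, z ∈ₘ x → ¬ z ∈ₘ y
  pairing : ∀ x y : M, ∃ p, IsPair p x y
  union : ∀ x : M, ∃ y, ∀ z, z ∈ₘ y ↔ ∃ t, t ∈ₘ x ∧ z ∈ₘ t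
  powerset : ∀ x : M, ∃ y, ∀ z, z ∈ₘ y ↔ Subs z x
  infinity : ∃ w : M, IsInductive w
  separation : ∀ D : Set M, (Set.univ : Set M).Definable₁ setLang D →
    ∀ a, ∃ b, ∀ x, x ∈ₘ b ↔ x ∈ₘ a ∧ x ∈ D
  replacement : ∀ R : M → M → Prop, (Set.univ : Set M).Definable₂ setLang {p | R p.1 p.2} →
    ∀ a, (∀ x, x ∈ₘ a → ∀ y y', R x y → R x y' → y = y') →
      ∃ b, ∀ y, y ∈ₘ b ↔ ∃ x, x ∈ₘ a ∧ R x y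

/-! ### Functions -/

/-- `p = (a, b)`, the Kuratowski ordered pair. -/
def IsOPair (p a b : M) : Prop := ∃ s d, IsPair s a a ∧ IsPair d a b ∧ IsPair p s d

/-- `(x, y) ∈ f`; for a function `f` this says `f(x) = y`. -/
def Val (f x y : M) : Prop := ∃ p, IsOPair p x y ∧ p ∈ₘ f

/-- `f` is a function with domain `a`. -/
def IsFun (f a : M) : Prop :=
  (∀ p, p ∈ₘ f → ∃ x y, x ∈ₘ a ∧ IsOPair p x y) ∧ ∀ x, x ∈ₘ a → ∃! y, Val f x y

/-- `f : a → b`. -/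
def MapsInto (f a b : M) : Prop := IsFun f a ∧ ∀ x y, Val f x y → y ∈ₘ b

def IsSurj (f a b : M) : Prop := MapsInto f a b ∧ ∀ y, y ∈ₘ b → ∃ x, Val f x y

def IsBij (f a b : M) : Prop :=
  IsSurj f a b ∧ ∀ x x' y, Val f x y → Val f x' y → x = x'

/-! ### Ordinals, cardinals, cofinality, the cumulative hierarchy -/

def IsTrans (x : M) : Prop := ∀ y, y ∈ₘ x → Subs y x

def IsOrd (x : M) : Prop := IsTrans x ∧ ∀ y, y ∈ₘ x → IsTrans y

/-- `a ≤ b` for ordinals. -/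
def Le (a b : M) : Prop := a = b ∨ a ∈ₘ b

/-- `w = ω`. -/
def IsOmega (w : M) : Prop := ∀ n, n ∈ₘ w ↔ ∀ i, IsInductive i → n ∈ₘ i

/-- `v = V_α`, by the recursion `V_β = ⋃ {𝒫(V_γ) | γ < β}`, carried out by a function `f` with
domain `α + 1`. -/
def IsV (α v : M) : Prop :=
  IsOrd α ∧ ∃ s f, IsSucc s α ∧ IsFun f s ∧
    (∀ β u, Val f β u → ∀ z, z ∈ₘ u ↔ ∃ γ t, γ ∈ₘ β ∧ Val f γ t ∧ Subs z t) ∧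
    Val f α v

/-- Cardinals are the initial ordinals. -/
def IsCard (κ : M) : Prop := IsOrd κ ∧ ∀ δ, δ ∈ₘ κ → ¬ ∃ f, IsBij f δ κ

def IsInfiniteCard (κ : M) : Prop := IsCard κ ∧ ∃ w, IsOmega w ∧ Le w κ

def IsUncountableCard (κ : M) : Prop := IsCard κ ∧ ∃ w, IsOmega w ∧ w ∈ₘ κ

/-- `μ = κ⁺`, the least cardinal above `κ`. -/
def IsSuccCard (μ κ : M) : Prop :=
  IsCard μ ∧ κ ∈ₘ μ ∧ ∀ ν, IsCard ν → κ ∈ₘ ν → Le μ ν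

/-- `f` is a cofinal map from the set `a` into the ordinal `α`. -/
def IsCofinalMap (f a α : M) : Prop :=
  MapsInto f a α ∧ ∀ β, β ∈ₘ α → ∃ x y, Val f x y ∧ Le β y

/-- `c = cf(α)`. -/
def IsCof (c α : M) : Prop :=
  IsOrd c ∧ (∃ f, IsCofinalMap f c α) ∧ ∀ d, d ∈ₘ c → ¬ ∃ f, IsCofinalMap f d α

def IsRegularCard (κ : M) : Prop := IsInfiniteCard κ ∧ IsCof κ κ

def IsSingularCard (κ : M) : Prop := IsInfiniteCard κ ∧ ∃ c, IsCof c κ ∧ c ∈ₘ κ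

/-! ### The club filter -/

/-- `C` is a closed unbounded subset of `μ`. -/
def IsClubIn (C μ : M) : Prop :=
  Subs C μ ∧ (∀ β, β ∈ₘ μ → ∃ ξ, ξ ∈ₘ C ∧ β ∈ₘ ξ) ∧
    ∀ δ, δ ∈ₘ μ → ¬ IsEmptySet δ → (∀ β, β ∈ₘ δ → ∃ ξ, ξ ∈ₘ C ∧ ξ ∈ₘ δ ∧ β ∈ₘ ξ) → δ ∈ₘ C

/-- `S` belongs to the club filter over `μ`. -/
def InClubFilter (S μ : M) : Prop := Subs S μ ∧ ∃ C, IsClubIn C μ ∧ Subs C S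

/-- `f` is a function from `x` into the club filter over `μ`. -/
def IsFunIntoClubFilter (f x μ : M) : Prop :=
  IsFun f x ∧ ∀ a S, Val f a S → InClubFilter S μ

/-- The intersection of the values of `f` contains a club in `μ`. -/
def InterContainsClub (f μ : M) : Prop :=
  ∃ C, IsClubIn C μ ∧ ∀ a S, Val f a S → Subs C S

/-- The club filter over `μ` is `κ`-complete: the intersection (within `μ`) of fewer than `κ`
members is a member. -/
def ClubFilterComplete (κ μ : M) : Prop :=
  ∀ δ f, δ ∈ₘ κ → IsFunIntoClubFilter f δ μ →
    ∃ D, (∀ ξ, ξ ∈ₘ D ↔ ξ ∈ₘ μ ∧ ∀ a S, Val f a S → ξ ∈ₘ S) ∧ InClubFilter D μ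

def IsStationaryIn (S μ : M) : Prop := Subs S μ ∧ ∀ C, IsClubIn C μ → ∃ ξ, ξ ∈ₘ C ∧ ξ ∈ₘ S

/-- `f : μ \ {0} → μ` is regressive. -/
def IsRegressive (f μ : M) : Prop :=
  (∃ d, (∀ ξ, ξ ∈ₘ d ↔ ξ ∈ₘ μ ∧ ¬ IsEmptySet ξ) ∧ MapsInto f d μ) ∧
    ∀ ξ η, Val f ξ η → η ∈ₘ ξ

/-! ### Formulas, satisfaction and elementary submodels, inside `M`

Formulas are coded by sets of `M` (`(0,(i,j))` for `v_i ∈ v_j`, `(1,(i,j))` for `v_i = v_j`,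
`(2,(0,0))` for falsum, `(3,(φ,ψ))` for `φ → ψ`, `(4,(i,φ))` for `∀ v_i φ`), variables being indexed
by the `ω` of `M`, so that satisfaction in a set structure is the notion of `M` itself. -/

/-- `x` is the von Neumann numeral of `k`. -/
def IsNumeral : ℕ → M → Prop
  | 0, x => IsEmptySet x
  | k + 1, x => ∃ y, IsNumeral k y ∧ IsSucc x y

/-- `c = (k, (a, b))`. -/
def IsCode (k : ℕ) (c a b : M) : Prop :=
  ∃ t p, IsNumeral k t ∧ IsOPair p a b ∧ IsOPair c t p

def IsMemCode (c i j : M) : Prop := IsCode 0 c i j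

def IsEqCode (c i j : M) : Prop := IsCode 1 c i j

def IsFalsumCode (c : M) : Prop := ∃ e, IsEmptySet e ∧ IsCode 2 c e e

def IsImpCode (c p q : M) : Prop := IsCode 3 c p q

def IsAllCode (c i p : M) : Prop := IsCode 4 c i p

/-- `F` contains the atomic formulas and is closed under implication and quantification. -/
def IsFormulaClosed (F : M) : Prop :=
  ∀ w, IsOmega w →
    (∀ c i j, i ∈ₘ w → j ∈ₘ w → IsMemCode c i j → c ∈ₘ F) ∧
    (∀ c i j, i ∈ₘ w → j ∈ₘ w → IsEqCode c i j → c ∈ₘ F) ∧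
    (∀ c, IsFalsumCode c → c ∈ₘ F) ∧
    (∀ c p q, p ∈ₘ F → q ∈ₘ F → IsImpCode c p q → c ∈ₘ F) ∧
    (∀ c i p, i ∈ₘ w → p ∈ₘ F → IsAllCode c i p → c ∈ₘ F)

/-- `c` is a formula: it lies in every set closed under the formation rules (`V_ω` is one). -/
def IsFormula (c : M) : Prop := ∀ F, IsFormulaClosed F → c ∈ₘ F

/-- `s` is an assignment of elements of `A` to all variables. -/
def IsAssignment (s A : M) : Prop := ∃ w, IsOmega w ∧ MapsInto s w A

/-- `s' = s[i ↦ a]`. -/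
def IsUpdate (s' s i a : M) : Prop :=
  Val s' i a ∧ ∀ j, j ≠ i → ∀ y, Val s' j y ↔ Val s j y

/-- `S` is a satisfaction relation for the structure `(A, ∈)`: the Tarski clauses hold for
all formulas and all assignments, where `(φ, s) ∈ S` says that `φ` holds in `A` at `s`. -/
def IsSatRel (A S : M) : Prop :=
  ∀ w, IsOmega w → ∀ s, IsAssignment s A →
    (∀ c i j, i ∈ₘ w → j ∈ₘ w → IsMemCode c i j →
      (Val S c s ↔ ∃ x y, Val s i x ∧ Val s j y ∧ x ∈ₘ y)) ∧
    (∀ c i j, i ∈ₘ w → j ∈ₘ w → IsEqCode c i j →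
      (Val S c s ↔ ∃ x, Val s i x ∧ Val s j x)) ∧
    (∀ c, IsFalsumCode c → ¬ Val S c s) ∧
    (∀ c p q, IsFormula p → IsFormula q → IsImpCode c p q →
      (Val S c s ↔ (Val S p s → Val S q s))) ∧
    (∀ c i p, i ∈ₘ w → IsFormula p → IsAllCode c i p →
      (Val S c s ↔ ∀ a s', a ∈ₘ A → IsAssignment s' A → IsUpdate s' s i a → Val S p s'))

/-- The formula `c` holds in `(A, ∈)` at the assignment `s`. -/
def Sat (A c s : M) : Prop := ∃ S, IsSatRel A S ∧ Val S c s

/-- `X ≺ A`. -/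
def IsElemSub (X A : M) : Prop :=
  (∃ x, x ∈ₘ X) ∧ Subs X A ∧
    ∀ c s, IsFormula c → IsAssignment s X → (Sat X c s ↔ Sat A c s)

/-- `T` is the transitive collapse of `X`: the range of the map `π` on `X` with
`π(x) = {π(y) | y ∈ X ∩ x}`. -/
def IsCollapse (T X : M) : Prop :=
  ∃ π, IsFun π X ∧
    (∀ x t, Val π x t → ∀ z, z ∈ₘ t ↔ ∃ y, y ∈ₘ X ∧ y ∈ₘ x ∧ Val π y z) ∧
    ∀ z, z ∈ₘ T ↔ ∃ x, Val π x z

/-- `κ` is a weakly Löwenheim-Skolem cardinal. -/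
def IsWeaklyLS (κ : M) : Prop :=
  IsUncountableCard κ ∧
    ∀ γ α Vγ Vα Vκ x, γ ∈ₘ κ → Le κ α → IsV γ Vγ → IsV α Vα → IsV κ Vκ → x ∈ₘ Vα →
      ∃ X, IsElemSub X Vα ∧ Subs Vγ X ∧ x ∈ₘ X ∧ ∃ T, IsCollapse T X ∧ T ∈ₘ Vκ

end

end ChoicelessLS

open ChoicelessLS

set_option linter.unusedSectionVars false

/-! Without choice one cannot pick a surjection from `λ` onto each ordinal below `λ⁺`, nor a club
inside each member of the club filter. The weakly LS property replaces such selections by hulls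
(`IsWeaklyLS.exists_hull`). Given `x ∈ V_κ` and a definable relation, code the relation as a set and
take an elementary `X ≺ V_α` that includes `x` and has the code as an element. Whenever members of
`X` have a witness, they have one in `X`. The collapse of `X` is injective, so `X` is the image of
some `T ∈ V_κ`. Using all witnesses in `X` at once makes selection unnecessary.

No hull includes `κ`, since its collapse would then include `κ` too. A hull closed under a map from
`x` onto `κ` would include `κ`, so there is no such map.

Boundedness rests on `IsWeaklyLS.not_onto_prod`: `T × λ` does not map onto `λ⁺`. For fixed `η < λ`
the values at `(t, η)` form an image of `T`, so their order type is below `κ`. Collapsing each of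
these slices would turn the map into one from `λ × λ` onto `λ⁺`, against the Hessenberg argument in
`IsWeaklyLS.not_onto_prod_self`. If a map from `x` were unbounded in `λ⁺`, a hull would contain
surjections from `λ` onto its values, and these, indexed by `T`, would map `T × λ` onto `λ⁺`
(`IsWeaklyLS.exists_bound`).

By boundedness the ordinals below `λ⁺` in a hull have supremum `δ < λ⁺`. If the hull is closed under
moving upwards into the clubs in question, `δ` lies in all of them. This gives completeness of the
filter and the weak form of Fodor's lemma.

When `λ` itself is singular and weakly LS, `V_λ` is a union of sets of `V_λ` indexed by `cf(λ) < λ`.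
Applying the previous results within each level and then across levels bounds maps from all of `V_λ`
and intersects clubs indexed by it. As `λ ⊆ V_λ` maps onto every smaller ordinal of `λ⁺`, regularity
and `λ⁺`-completeness follow. Full Fodor follows from the weak form by intersecting the complements
of the fibres below the bound. -/

namespace ChoicelessLS

/-! ### Definability with parameters, discharged by instance search -/

section Definability

open FirstOrder Language

variable {M : Type*} [setLang.Structure M]

/-- The environment `v` without its first entry. -/
abbrev tl (v : ℕ → M) : ℕ → M := fun i => v (i + 1)

/-- `P` is definable with parameters, the variables being interpreted by an environment. -/
class FO (P : (ℕ → M) → Prop) : Prop where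
  out : ∃ φ : setLang.Formula (M ⊕ ℕ), ∀ v, φ.Realize (Sum.elim id v) ↔ P v

/-- The graph of `t` is definable with parameters. -/
class DF (t : (ℕ → M) → M) : Prop where
  out : FO fun v => v 0 = t (tl v)

theorem FO.congr {P Q : (ℕ → M) → Prop} (h : FO P) (hPQ : ∀ v, P v ↔ Q v) : FO Q := by
  obtain ⟨φ, hφ⟩ := h.out
  exact ⟨φ, fun v => (hφ v).trans (hPQ v)⟩

theorem FO.relabel {P : (ℕ → M) → Prop} (h : FO P) (σ : ℕ → ℕ) :
    FO fun v => P fun i => v (σ i) := by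
  obtain ⟨φ, hφ⟩ := h.out
  refine ⟨Formula.relabel (Sum.map id σ) φ, fun v => ?_⟩
  rw [Formula.realize_relabel, ← hφ]
  have : (Sum.elim id v : M ⊕ ℕ → M) ∘ Sum.map id σ = Sum.elim id fun i => v (σ i) := by
    funext x; cases x <;> rfl
  rw [this]

instance FO.and {P Q : (ℕ → M) → Prop} [hP : FO P] [hQ : FO Q] : FO fun v => P v ∧ Q v := by
  obtain ⟨φ, hφ⟩ := hP.out
  obtain ⟨ψ, hψ⟩ := hQ.out
  exact ⟨φ ⊓ ψ, fun v => by rw [Formula.realize_inf, hφ, hψ]⟩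

instance FO.not {P : (ℕ → M) → Prop} [hP : FO P] : FO fun v => ¬ P v := by
  obtain ⟨φ, hφ⟩ := hP.out
  exact ⟨φ.not, fun v => by rw [Formula.realize_not, hφ]⟩

instance FO.or {P Q : (ℕ → M) → Prop} [FO P] [FO Q] : FO fun v => P v ∨ Q v :=
  FO.congr (P := fun v => ¬ (¬ P v ∧ ¬ Q v)) inferInstance fun v => by tauto

instance FO.imp {P Q : (ℕ → M) → Prop} [FO P] [FO Q] : FO fun v => P v → Q v :=
  FO.congr (P := fun v => ¬ P v ∨ Q v) inferInstance fun v => by tauto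

instance FO.iff {P Q : (ℕ → M) → Prop} [FO P] [FO Q] : FO fun v => P v ↔ Q v :=
  FO.congr (P := fun v => (P v → Q v) ∧ (Q v → P v)) inferInstance fun v => by tauto

/-- Binding follows de Bruijn: the body is tested on environments whose entry `0` is the bound
variable and whose tail is the old environment. Instance search can therefore peel off nested
quantifiers. -/
instance FO.ex {P : M → (ℕ → M) → Prop} [h : FO fun v => P (v 0) (tl v)] :
    FO fun v => ∃ x, P x v := by
  obtain ⟨φ, hφ⟩ := h.out
  let g : M ⊕ ℕ → (M ⊕ ℕ) ⊕ Fin 1 := fun x => match x with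
    | Sum.inl a => Sum.inl (Sum.inl a)
    | Sum.inr 0 => Sum.inr 0
    | Sum.inr (n + 1) => Sum.inl (Sum.inr n)
  refine ⟨(BoundedFormula.relabel g φ : setLang.BoundedFormula (M ⊕ ℕ) 1).ex, fun v => ?_⟩
  rw [Formula.Realize, BoundedFormula.realize_ex]
  refine exists_congr fun a => ?_
  rw [BoundedFormula.realize_relabel]
  have key := hφ (fun n => Nat.casesOn n a v)
  rw [Formula.Realize] at key
  rw [show P a v ↔ P ((fun n => Nat.casesOn n a v : ℕ → M) 0)
    (tl (fun n => Nat.casesOn n a v : ℕ → M)) from Iff.rfl, ← key]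
  have e : (Sum.elim (Sum.elim id v) ((Fin.snoc default a : Fin 1 → M) ∘ Fin.castAdd 0) ∘ g)
      = (Sum.elim id (fun n => Nat.casesOn n a v) : M ⊕ ℕ → M) := by
    funext x
    rcases x with x | n
    · rfl
    · cases n <;> rfl
  rw [e]
  exact iff_of_eq (congrArg _ (Subsingleton.elim _ _))

instance FO.all {P : M → (ℕ → M) → Prop} [FO fun v => P (v 0) (tl v)] :
    FO fun v => ∀ x, P x v :=
  FO.congr (P := fun v => ¬ ∃ x, ¬ P x v) inferInstance fun v => by push Not; rfl

/-- A proposition that ignores the environment is equivalent to `⊤` or to `⊥`, so subformulas that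
mention only parameters cost nothing. -/
instance FO.const {p : Prop} : FO fun _ : ℕ → M => p := by
  by_cases h : p
  · exact ⟨⊤, fun v => by simp [h]⟩
  · exact ⟨⊥, fun v => by simp [h]⟩

instance DF.var {n : ℕ} : DF fun v : ℕ → M => v n :=
  ⟨⟨(Term.var (Sum.inr 0)).equal (Term.var (Sum.inr (n + 1))), fun v => by simp⟩⟩

instance DF.const {c : M} : DF fun _ : ℕ → M => c :=
  ⟨⟨(Term.var (Sum.inr 0)).equal (Term.var (Sum.inl c)), fun v => by simp⟩⟩

/-- Only the graph of a term is definable, so the term is replaced by a quantified variable equal to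
it. -/
theorem FO.subst {P : M → (ℕ → M) → Prop} {t : (ℕ → M) → M} [ht : DF t]
    [FO fun v => P (v 0) (tl v)] : FO fun v => P (t v) v :=
  haveI := ht.out
  FO.congr (P := fun v => ∃ x, x = t v ∧ P x v) inferInstance fun v => by simp

instance (priority := 500) DF.relabel {t : (ℕ → M) → M} [ht : DF t] {σ : ℕ → ℕ} :
    DF fun v => t fun i => v (σ i) :=
  ⟨(ht.out.relabel fun n => Nat.casesOn n 0 fun k => σ k + 1).congr fun _ => Iff.rfl⟩

theorem FO.subst₂ {R : M → M → Prop} (h : FO fun v : ℕ → M => R (v 0) (v 1))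
    {t u : (ℕ → M) → M} [DF t] [DF u] : FO fun v => R (t v) (u v) := by
  -- Truncated subtraction: `1 - n` exchanges the variables `0` and `1`.
  have h1 : FO fun v : ℕ → M => R (v 1) (v 0) := h.relabel fun n => 1 - n
  have h2 : FO fun v : ℕ → M => R (v 0) (u (tl v)) :=
    FO.subst (P := fun x v => R (v 0) x) (t := fun v => u (tl v))
  exact FO.subst (P := fun x v => R x (u v))

/-- The membership symbol. -/
def memSymbol : setLang.Relations 2 := MemRel.mem

theorem FO.subst₃ {K : M → M → M → Prop} (h : FO fun v : ℕ → M => K (v 0) (v 1) (v 2))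
    {t u w : (ℕ → M) → M} [DF t] [DF u] [DF w] : FO fun v => K (t v) (u v) (w v) := by
  have h1 : FO fun v : ℕ → M => K (v 1) (v 2) (v 0) := h.relabel fun n => (n + 1) % 3
  have h2 : FO fun v : ℕ → M => K (v 0) (v 1) (w fun i => v (i + 1 + 1)) :=
    FO.subst (P := fun x v => K (v 0) (v 1) x) (t := fun v => w fun i => v (i + 1 + 1))
  have h3 : FO fun v : ℕ → M => K (v 1) (v 0) (w fun i => v (i + 1 + 1)) :=
    h2.relabel fun n => Nat.casesOn n 1 fun n => Nat.casesOn n 0 fun k => k + 2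
  have h4 : FO fun v : ℕ → M => K (v 0) (u (tl v)) (w (tl v)) :=
    FO.subst (P := fun x v => K (v 0) x (w (tl v))) (t := fun v => u (tl v))
  exact FO.subst (P := fun x v => K x (u v) (w v))

instance FO.mem {t u : (ℕ → M) → M} [DF t] [DF u] : FO fun v => t v ∈ₘ u v :=
  FO.subst₂ (R := Mem) ⟨memSymbol.formula₂ (Term.var (Sum.inr 0)) (Term.var (Sum.inr 1)),
    fun v => by rw [Formula.realize_rel₂]; rfl⟩

instance FO.eq {t u : (ℕ → M) → M} [DF t] [DF u] : FO fun v => t v = u v :=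
  FO.subst₂ (R := fun x y => x = y) (DF.var (n := 0)).out

instance FO.ne {t u : (ℕ → M) → M} [DF t] [DF u] : FO fun v => t v ≠ u v :=
  inferInstanceAs (FO fun v => ¬ t v = u v)

instance FO.exu {P : M → (ℕ → M) → Prop} [h : FO fun v => P (v 0) (tl v)] :
    FO fun v => ∃! x, P x v := by
  have : FO fun v : ℕ → M => P (v 0) (tl (tl v)) :=
    h.relabel fun n => Nat.casesOn n 0 fun k => k + 2
  exact FO.congr (P := fun v => ∃ x, P x v ∧ ∀ y, P y v → y = x) inferInstance fun v => Iff.rfl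

variable {t u w s : (ℕ → M) → M} [DF t] [DF u] [DF w] [DF s]

instance : FO fun v => Subs (t v) (u v) := by unfold Subs; infer_instance
instance : FO fun v => IsEmptySet (t v) := by unfold IsEmptySet; infer_instance
instance : FO fun v => IsSucc (t v) (u v) := by unfold IsSucc; infer_instance
instance : FO fun v => IsInductive (t v) := by unfold IsInductive; infer_instance
instance : FO fun v => IsPair (t v) (u v) (w v) := by unfold IsPair; infer_instance
instance : FO fun v => IsOPair (t v) (u v) (w v) := by unfold IsOPair; infer_instance
instance : FO fun v => Val (t v) (u v) (w v) := by unfold Val; infer_instance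
instance : FO fun v => IsFun (t v) (u v) := by unfold IsFun; infer_instance
instance : FO fun v => MapsInto (t v) (u v) (w v) := by unfold MapsInto; infer_instance
instance : FO fun v => IsSurj (t v) (u v) (w v) := by unfold IsSurj; infer_instance
instance : FO fun v => IsBij (t v) (u v) (w v) := by unfold IsBij; infer_instance
instance : FO fun v => IsTrans (t v) := by unfold IsTrans; infer_instance
instance : FO fun v => IsOrd (t v) := by unfold IsOrd; infer_instance
instance : FO fun v => Le (t v) (u v) := by unfold Le; infer_instance
instance : FO fun v => IsOmega (t v) := by unfold IsOmega; infer_instance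
instance : FO fun v => IsV (t v) (u v) := by unfold IsV; infer_instance
instance : FO fun v => IsCard (t v) := by unfold IsCard; infer_instance
instance : FO fun v => IsCofinalMap (t v) (u v) (w v) := by unfold IsCofinalMap; infer_instance
instance : FO fun v => IsClubIn (t v) (u v) := by unfold IsClubIn; infer_instance

instance {k : ℕ} : FO fun v => IsNumeral k (t v) := by
  induction k generalizing t with
  | zero => unfold IsNumeral; infer_instance
  | succ k ih => unfold IsNumeral; infer_instance

instance {k : ℕ} : FO fun v => IsCode k (t v) (u v) (w v) := by unfold IsCode; infer_instance
instance : FO fun v => IsMemCode (t v) (u v) (w v) := by unfold IsMemCode; infer_instance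
instance : FO fun v => IsEqCode (t v) (u v) (w v) := by unfold IsEqCode; infer_instance
instance : FO fun v => IsFalsumCode (t v) := by unfold IsFalsumCode; infer_instance
instance : FO fun v => IsImpCode (t v) (u v) (w v) := by unfold IsImpCode; infer_instance
instance : FO fun v => IsAllCode (t v) (u v) (w v) := by unfold IsAllCode; infer_instance
instance : FO fun v => IsFormulaClosed (t v) := by unfold IsFormulaClosed; infer_instance
instance : FO fun v => IsFormula (t v) := by unfold IsFormula; infer_instance
instance : FO fun v => IsAssignment (t v) (u v) := by unfold IsAssignment; infer_instance
instance : FO fun v => IsUpdate (t v) (u v) (w v) (s v) := by unfold IsUpdate; infer_instance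

end Definability

/-! ### Basic set operations in a model of ZF -/

variable {M : Type*} [setLang.Structure M]

variable (M) in
/-- `M` is a model of ZF, as a class. -/
class ZF : Prop where
  out : IsZFModel M

/-- The separation scheme with its definability condition left to instance search, so that no
formula has to be written down. -/
theorem sep [h : ZF M] (a : M) (P : M → Prop) [hP : FO fun v : ℕ → M => P (v 0)] :
    ∃ b, ∀ x, x ∈ₘ b ↔ x ∈ₘ a ∧ P x := by
  refine h.out.separation {x | P x} ?_ a
  obtain ⟨φ, hφ⟩ := hP.out
  rw [Set.Definable₁, Set.definable_iff_exists_formula_sum]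
  refine ⟨FirstOrder.Language.Formula.relabel (Sum.map (fun a => ⟨a, trivial⟩) fun _ => 0) φ, ?_⟩
  ext v
  have e : (Sum.elim (fun x : (Set.univ : Set M) => (x : M)) v : _ ⊕ Fin 1 → M) ∘
      Sum.map (fun a => ⟨a, trivial⟩) (fun _ : ℕ => (0 : Fin 1)) =
      Sum.elim id fun _ => v 0 := by
    funext x; cases x <;> rfl
  show P (v 0) ↔ FirstOrder.Language.Formula.Realize _ _
  rw [FirstOrder.Language.Formula.realize_relabel, e, hφ]

theorem repl [h : ZF M] (a : M) (R : M → M → Prop) [hR : FO fun v : ℕ → M => R (v 0) (v 1)]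
    (hf : ∀ x, x ∈ₘ a → ∀ y y', R x y → R x y' → y = y') :
    ∃ b, ∀ y, y ∈ₘ b ↔ ∃ x, x ∈ₘ a ∧ R x y := by
  refine h.out.replacement R ?_ a hf
  obtain ⟨φ, hφ⟩ := hR.out
  rw [Set.Definable₂, Set.definable_iff_exists_formula_sum]
  refine ⟨FirstOrder.Language.Formula.relabel (Sum.map (fun a => ⟨a, trivial⟩) fun n => Nat.casesOn n 0 fun _ => 1) φ,
    ?_⟩
  ext v
  have e : (Sum.elim (fun x : (Set.univ : Set M) => (x : M)) v : _ ⊕ Fin 2 → M) ∘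
      Sum.map (fun a => ⟨a, trivial⟩) (fun n : ℕ => (Nat.casesOn n 0 fun _ => 1 : Fin 2)) =
      Sum.elim id fun n => Nat.casesOn n (v 0) fun _ => v 1 := by
    funext x; rcases x with x | n
    · rfl
    · cases n <;> rfl
  show R (v 0) (v 1) ↔ FirstOrder.Language.Formula.Realize _ _
  rw [FirstOrder.Language.Formula.realize_relabel, e]
  exact (hφ fun n => Nat.casesOn n (v 0) fun _ => v 1).symm

variable [ZF M]

theorem ext {x y : M} (h : ∀ z, z ∈ₘ x ↔ z ∈ₘ y) : x = y := ZF.out.extensionality x y h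

theorem Subs.antisymm {x y : M} (h : Subs x y) (h' : Subs y x) : x = y :=
  ext fun z => ⟨h z, h' z⟩

theorem Subs.refl (x : M) : Subs x x := fun _ h => h

theorem Subs.trans {x y z : M} (h : Subs x y) (h' : Subs y z) : Subs x z :=
  fun _ hu => h' _ (h _ hu)

theorem exists_isEmptySet : ∃ e : M, IsEmptySet e := by
  obtain ⟨w, ⟨e, he, -⟩, -⟩ := (ZF.out : IsZFModel M).infinity
  exact ⟨e, he⟩

variable (M) in
/-- The empty set of `M`. -/
noncomputable def emp : M := (exists_isEmptySet (M := M)).choose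

theorem not_mem_emp {x : M} : ¬ x ∈ₘ emp M := (exists_isEmptySet (M := M)).choose_spec x

theorem isEmptySet_iff {x : M} : IsEmptySet x ↔ x = emp M :=
  ⟨fun h => ext fun z => ⟨fun hz => (h z hz).elim, fun hz => (not_mem_emp hz).elim⟩,
    fun h => h ▸ fun _ => not_mem_emp⟩

/-- The unordered pair. -/
noncomputable def upair (a b : M) : M := (ZF.out.pairing a b).choose

theorem isPair_upair (a b : M) : IsPair (upair a b) a b := (ZF.out.pairing a b).choose_spec

theorem mem_upair {a b z : M} : z ∈ₘ upair a b ↔ z = a ∨ z = b := isPair_upair a b z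

theorem isPair_iff {p a b : M} : IsPair p a b ↔ p = upair a b :=
  ⟨fun h => ext fun z => (h z).trans mem_upair.symm, fun h => h ▸ isPair_upair a b⟩

/-- The union of a set. -/
noncomputable def sUnion (x : M) : M := (ZF.out.union x).choose

theorem mem_sUnion {x z : M} : z ∈ₘ sUnion x ↔ ∃ t, t ∈ₘ x ∧ z ∈ₘ t :=
  (ZF.out.union x).choose_spec z

/-- The union of two sets. -/
noncomputable def union (x y : M) : M := sUnion (upair x y)

theorem mem_union {x y z : M} : z ∈ₘ union x y ↔ z ∈ₘ x ∨ z ∈ₘ y := by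
  simp [union, mem_sUnion, mem_upair]

/-- The power set. -/
noncomputable def pow (x : M) : M := (ZF.out.powerset x).choose

theorem mem_pow {x z : M} : z ∈ₘ pow x ↔ Subs z x := (ZF.out.powerset x).choose_spec z

/-- `x ∪ {x}`. -/
noncomputable def succ (x : M) : M := union x (upair x x)

theorem mem_succ {x z : M} : z ∈ₘ succ x ↔ z ∈ₘ x ∨ z = x := by
  simp [succ, mem_union, mem_upair]

theorem isSucc_iff {y x : M} : IsSucc y x ↔ y = succ x :=
  ⟨fun h => ext fun z => (h z).trans mem_succ.symm, fun h => h ▸ fun _ => mem_succ⟩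

theorem mem_succ_self (x : M) : x ∈ₘ succ x := mem_succ.2 (.inr rfl)

/-- The Kuratowski ordered pair. -/
noncomputable def opair (a b : M) : M := upair (upair a a) (upair a b)

theorem isOPair_iff {p a b : M} : IsOPair p a b ↔ p = opair a b := by
  simp [IsOPair, isPair_iff, opair]

theorem upair_injective {a b c d : M} (h : upair a b = upair c d) :
    (a = c ∧ b = d) ∨ (a = d ∧ b = c) := by
  have h1 : a = c ∨ a = d := mem_upair.1 (h ▸ mem_upair.2 (.inl rfl))
  have h2 : b = c ∨ b = d := mem_upair.1 (h ▸ mem_upair.2 (.inr rfl))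
  have h3 : c = a ∨ c = b := mem_upair.1 (h ▸ mem_upair.2 (.inl rfl))
  have h4 : d = a ∨ d = b := mem_upair.1 (h ▸ mem_upair.2 (.inr rfl))
  grind

theorem opair_inj {a b c d : M} : opair a b = opair c d ↔ a = c ∧ b = d := by
  refine ⟨fun h => ?_, fun h => by rw [h.1, h.2]⟩
  rcases upair_injective h with ⟨h1, h2⟩ | ⟨h1, h2⟩
  · have := upair_injective h1
    have := upair_injective h2
    grind
  · have := upair_injective h1
    have := upair_injective h2
    grind

theorem val_iff {f x y : M} : Val f x y ↔ opair x y ∈ₘ f := by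
  simp [Val, isOPair_iff]

section

variable {t u w : (ℕ → M) → M} [DF t] [DF u] [DF w]

instance : DF fun v => upair (t v) (u v) :=
  ⟨FO.congr (P := fun v => IsPair (v 0) (t (tl v)) (u (tl v))) inferInstance fun _ => isPair_iff⟩

instance : DF fun v => sUnion (t v) :=
  ⟨FO.congr (P := fun v => ∀ z, z ∈ₘ v 0 ↔ ∃ s, s ∈ₘ t (tl v) ∧ z ∈ₘ s) inferInstance fun _ =>
    ⟨fun h => ext fun z => (h z).trans mem_sUnion.symm, fun h => h ▸ fun _ => mem_sUnion⟩⟩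

instance : DF fun v => union (t v) (u v) := by unfold union; infer_instance
instance : DF fun v => succ (t v) := by unfold succ; infer_instance
instance : DF fun v => opair (t v) (u v) := by unfold opair; infer_instance

end

theorem exists_prod (a b : M) : ∃ p, ∀ z, z ∈ₘ p ↔ ∃ x y, x ∈ₘ a ∧ y ∈ₘ b ∧ z = opair x y := by
  obtain ⟨p, hp⟩ := sep (pow (pow (union a b)))
    (fun z => ∃ x y, x ∈ₘ a ∧ y ∈ₘ b ∧ z = opair x y)
  refine ⟨p, fun z => (hp z).trans ⟨fun h => h.2, fun h => ⟨?_, h⟩⟩⟩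
  obtain ⟨x, y, hx, hy, rfl⟩ := h
  refine mem_pow.2 fun s hs => mem_pow.2 fun r hr => mem_union.2 ?_
  rcases mem_upair.1 hs with rfl | rfl <;> rcases mem_upair.1 hr with rfl | rfl <;> simp [*]

/-- The cartesian product. -/
noncomputable def prod (a b : M) : M := (exists_prod a b).choose

theorem mem_prod {a b z : M} : z ∈ₘ prod a b ↔ ∃ x y, x ∈ₘ a ∧ y ∈ₘ b ∧ z = opair x y :=
  (exists_prod a b).choose_spec z

theorem opair_mem_prod {a b x y : M} : opair x y ∈ₘ prod a b ↔ x ∈ₘ a ∧ y ∈ₘ b := by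
  rw [mem_prod]
  constructor
  · rintro ⟨x', y', hx, hy, h⟩
    obtain ⟨rfl, rfl⟩ := opair_inj.1 h
    exact ⟨hx, hy⟩
  · exact fun h => ⟨x, y, h.1, h.2, rfl⟩

instance {t u : (ℕ → M) → M} [DF t] [DF u] : DF fun v => prod (t v) (u v) :=
  ⟨FO.congr (P := fun v => ∀ z, z ∈ₘ v 0 ↔
      ∃ x y, x ∈ₘ t (tl v) ∧ y ∈ₘ u (tl v) ∧ z = opair x y) inferInstance fun _ =>
    ⟨fun h => ext fun z => (h z).trans mem_prod.symm, fun h => h ▸ fun _ => mem_prod⟩⟩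

/-! ### Functions as sets -/

theorem exists_partial (a : M) (R : M → M → Prop) [FO fun v : ℕ → M => R (v 0) (v 1)]
    (hf : ∀ x, x ∈ₘ a → ∀ y y', R x y → R x y' → y = y') :
    ∃ f, (∀ p, p ∈ₘ f → ∃ x y, x ∈ₘ a ∧ IsOPair p x y) ∧
      ∀ x y, Val f x y ↔ x ∈ₘ a ∧ R x y := by
  -- The hypothesis covers `R` at two variables only; this local instance lets the search use `R` at
  -- arbitrary definable terms.
  have : ∀ (t u : (ℕ → M) → M) [DF t] [DF u], FO fun v => R (t v) (u v) :=
    fun t u _ _ => FO.subst₂ ‹_›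
  obtain ⟨f, hfm⟩ := repl a (fun x p => ∃ y, R x y ∧ p = opair x y) (by
    rintro x hx p p' ⟨y, hy, rfl⟩ ⟨y', hy', rfl⟩
    rw [hf x hx y y' hy hy'])
  refine ⟨f, fun p hp => ?_, fun x y => ?_⟩
  · obtain ⟨x, hx, y, hy, rfl⟩ := (hfm p).1 hp
    exact ⟨x, y, hx, isOPair_iff.2 rfl⟩
  · rw [val_iff, hfm]
    constructor
    · rintro ⟨x', hx', y', hy', h⟩
      obtain ⟨rfl, rfl⟩ := opair_inj.1 h
      exact ⟨hx', hy'⟩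
    · exact fun h => ⟨x, h.1, y, h.2, rfl⟩

theorem exists_fun (a : M) (R : M → M → Prop) [FO fun v : ℕ → M => R (v 0) (v 1)]
    (he : ∀ x, x ∈ₘ a → ∃ y, R x y)
    (hf : ∀ x, x ∈ₘ a → ∀ y y', R x y → R x y' → y = y') :
    ∃ f, IsFun f a ∧ ∀ x y, Val f x y ↔ x ∈ₘ a ∧ R x y := by
  obtain ⟨f, h1, h2⟩ := exists_partial a R hf
  refine ⟨f, ⟨h1, fun x hx => ?_⟩, h2⟩
  obtain ⟨y, hy⟩ := he x hx
  exact ⟨y, (h2 x y).2 ⟨hx, hy⟩, fun y' hy' => hf x hx _ _ ((h2 x y').1 hy').2 hy⟩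

theorem IsFun.mem_dom {f a x y : M} (h : IsFun f a) (hv : Val f x y) : x ∈ₘ a := by
  obtain ⟨x', y', hx, hp⟩ := h.1 _ (val_iff.1 hv)
  obtain ⟨rfl, rfl⟩ := opair_inj.1 (isOPair_iff.1 hp)
  exact hx

theorem IsFun.unique {f a x y y' : M} (h : IsFun f a) (hv : Val f x y) (hv' : Val f x y') :
    y = y' :=
  (h.2 x (h.mem_dom hv)).unique hv hv'

theorem IsFun.exists_val {f a x : M} (h : IsFun f a) (hx : x ∈ₘ a) : ∃ y, Val f x y :=
  (h.2 x hx).exists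

/-- The set of values of a relation. -/
theorem exists_range (f : M) : ∃ r, ∀ y, y ∈ₘ r ↔ ∃ x, Val f x y := by
  obtain ⟨r, hr⟩ := sep (sUnion (sUnion f)) (fun y => ∃ x, Val f x y)
  refine ⟨r, fun y => (hr y).trans ⟨fun h => h.2, fun h => ⟨?_, h⟩⟩⟩
  obtain ⟨x, hx⟩ := h
  exact mem_sUnion.2 ⟨upair x y, mem_sUnion.2 ⟨_, val_iff.1 hx, mem_upair.2 (.inr rfl)⟩,
    mem_upair.2 (.inr rfl)⟩

/-- Some partial function on `A` takes every element of `B` as a value. -/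
def Onto (A B : M) : Prop :=
  ∃ f, (∀ x y y', Val f x y → Val f x y' → y = y') ∧ ∀ y, y ∈ₘ B → ∃ x, x ∈ₘ A ∧ Val f x y

instance {t u : (ℕ → M) → M} [DF t] [DF u] : FO fun v => Onto (t v) (u v) := by
  unfold Onto; infer_instance

/-- Sizes are compared by surjections throughout. Allowing partial functions with stray values makes
the notion transitive and monotone without default values, and any definable relation that is
functional on `A` will do. -/
theorem Onto.of_rel {A B : M} (R : M → M → Prop) [FO fun v : ℕ → M => R (v 0) (v 1)]
    (hf : ∀ x y y', x ∈ₘ A → R x y → R x y' → y = y')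
    (hB : ∀ y, y ∈ₘ B → ∃ x, x ∈ₘ A ∧ R x y) : Onto A B := by
  obtain ⟨f, -, h⟩ := exists_partial A R fun x hx y y' => hf x y y' hx
  refine ⟨f, fun x y y' hy hy' => ?_, fun y hy => ?_⟩
  · rw [h] at hy hy'
    exact hf x y y' hy.1 hy.2 hy'.2
  · obtain ⟨x, hx, hxy⟩ := hB y hy
    exact ⟨x, hx, (h x y).2 ⟨hx, hxy⟩⟩

theorem Onto.trans {A B C : M} (h : Onto A B) (h' : Onto B C) : Onto A C := by
  obtain ⟨f, hf, hfB⟩ := h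
  obtain ⟨g, hg, hgC⟩ := h'
  refine Onto.of_rel (fun x z => ∃ y, Val f x y ∧ Val g y z) ?_ ?_
  · rintro x z z' - ⟨y, hy, hz⟩ ⟨y', hy', hz'⟩
    obtain rfl := hf x y y' hy hy'
    exact hg y z z' hz hz'
  · intro z hz
    obtain ⟨y, hy, hyz⟩ := hgC z hz
    obtain ⟨x, hx, hxy⟩ := hfB y hy
    exact ⟨x, hx, y, hxy, hyz⟩

theorem Onto.mono {A A' B B' : M} (h : Onto A B) (hA : Subs A A') (hB : Subs B' B) :
    Onto A' B' := by
  obtain ⟨f, hf, hfB⟩ := h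
  refine ⟨f, hf, fun y hy => ?_⟩
  obtain ⟨x, hx, hxy⟩ := hfB y (hB y hy)
  exact ⟨x, hA x hx, hxy⟩

theorem Onto.refl (A : M) : Onto A A :=
  Onto.of_rel (fun x y => x = y) (by rintro x y y' - rfl rfl; rfl) fun y hy => ⟨y, hy, rfl⟩

theorem Onto.of_subs {A B : M} (h : Subs B A) : Onto A B := (Onto.refl A).mono (Subs.refl A) h

theorem Onto.prod {A B C D : M} (h : Onto A B) (h' : Onto C D) :
    Onto (prod A C) (ChoicelessLS.prod B D) := by
  obtain ⟨f, hf, hfB⟩ := h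
  obtain ⟨g, hg, hgD⟩ := h'
  refine Onto.of_rel (fun x y => ∃ a c b d, x = opair a c ∧ y = opair b d ∧ Val f a b ∧ Val g c d)
    ?_ ?_
  · rintro x y y' - ⟨a, c, b, d, rfl, rfl, hab, hcd⟩ ⟨a', c', b', d', h, rfl, hab', hcd'⟩
    obtain ⟨rfl, rfl⟩ := opair_inj.1 h
    rw [hf _ _ _ hab hab', hg _ _ _ hcd hcd']
  · intro y hy
    obtain ⟨b, d, hb, hd, rfl⟩ := mem_prod.1 hy
    obtain ⟨a, ha, hab⟩ := hfB b hb
    obtain ⟨c, hc, hcd⟩ := hgD d hd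
    exact ⟨opair a c, opair_mem_prod.2 ⟨ha, hc⟩, a, c, b, d, rfl, rfl, hab, hcd⟩

theorem IsSurj.onto {f A B : M} (h : IsSurj f A B) : Onto A B :=
  ⟨f, fun _ _ _ => h.1.1.unique, fun y hy => by
    obtain ⟨x, hx⟩ := h.2 y hy
    exact ⟨x, h.1.1.mem_dom hx, hx⟩⟩

/-! ### Ordinals -/

theorem exists_minimal {x : M} (h : ∃ y, y ∈ₘ x) : ∃ y, y ∈ₘ x ∧ ∀ z, z ∈ₘ x → ¬ z ∈ₘ y :=
  ZF.out.foundation x h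

theorem mem_irrefl (x : M) : ¬ x ∈ₘ x := by
  intro h
  obtain ⟨y, hy, hm⟩ := exists_minimal (x := upair x x) ⟨x, mem_upair.2 (.inl rfl)⟩
  obtain rfl : y = x := by simpa [mem_upair] using hy
  exact hm y hy h

theorem mem_asymm {x y : M} (h : x ∈ₘ y) : ¬ y ∈ₘ x := by
  intro h'
  obtain ⟨z, hz, hm⟩ := exists_minimal (x := upair x y) ⟨x, mem_upair.2 (.inl rfl)⟩
  rcases mem_upair.1 hz with rfl | rfl
  · exact hm y (mem_upair.2 (.inr rfl)) h'
  · exact hm x (mem_upair.2 (.inl rfl)) h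

theorem IsOrd.trans {α β γ : M} (h : IsOrd α) (hβ : β ∈ₘ α) (hγ : γ ∈ₘ β) : γ ∈ₘ α :=
  h.1 β hβ γ hγ

theorem IsOrd.mem {α β : M} (h : IsOrd α) (hβ : β ∈ₘ α) : IsOrd β :=
  ⟨h.2 β hβ, fun _ hγ => h.2 _ (h.trans hβ hγ)⟩

/-- Foundation speaks of sets, so the class is first cut down to `succ α`. -/
theorem ord_min (P : M → Prop) [FO fun v : ℕ → M => P (v 0)] {α : M} (hα : IsOrd α) (h : P α) :
    ∃ β, IsOrd β ∧ P β ∧ Le β α ∧ ∀ γ, γ ∈ₘ β → ¬ P γ := by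
  obtain ⟨b, hb⟩ := sep (succ α) P
  obtain ⟨β, hβ, hm⟩ := exists_minimal (x := b) ⟨α, (hb α).2 ⟨mem_succ_self α, h⟩⟩
  rw [hb, mem_succ] at hβ
  refine ⟨β, ?_, hβ.2, hβ.1.symm, fun γ hγ hP => hm γ ((hb γ).2 ⟨?_, hP⟩) hγ⟩
  · rcases hβ.1 with h | rfl
    exacts [hα.mem h, hα]
  · rcases hβ.1 with h | rfl
    exacts [mem_succ.2 (.inl (hα.trans h hγ)), mem_succ.2 (.inl hγ)]

theorem ord_induction (P : M → Prop) [FO fun v : ℕ → M => P (v 0)]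
    (h : ∀ β, IsOrd β → (∀ γ, γ ∈ₘ β → P γ) → P β) {α : M} (hα : IsOrd α) : P α := by
  by_contra hP
  obtain ⟨β, hβ, hPβ, -, hm⟩ := ord_min (fun x => ¬ P x) hα hP
  exact hPβ (h β hβ fun γ hγ => not_not.1 (hm γ hγ))

/-- Double induction. If neither ordinal is at most an element of the other, the two induction
hypotheses put each element of either one into the other, so the ordinals are equal. -/
theorem IsOrd.trichotomy {α β : M} (hα : IsOrd α) (hβ : IsOrd β) : α ∈ₘ β ∨ α = β ∨ β ∈ₘ α := by
  refine ord_induction (fun α => ∀ β, IsOrd β → α ∈ₘ β ∨ α = β ∨ β ∈ₘ α) ?_ hα β hβ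
  intro α hα ih β hβ
  refine ord_induction (fun β => α ∈ₘ β ∨ α = β ∨ β ∈ₘ α) ?_ hβ
  intro β hβ ih'
  by_cases h1 : ∃ δ, δ ∈ₘ β ∧ (α ∈ₘ δ ∨ α = δ)
  · obtain ⟨δ, hδ, h | rfl⟩ := h1
    exacts [.inl (hβ.trans hδ h), .inl hδ]
  by_cases h2 : ∃ γ, γ ∈ₘ α ∧ (β ∈ₘ γ ∨ γ = β)
  · obtain ⟨γ, hγ, h | rfl⟩ := h2
    exacts [.inr (.inr (hα.trans hγ h)), .inr (.inr hγ)]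
  refine .inr (.inl (ext fun z => ⟨fun hz => ?_, fun hz => ?_⟩))
  · have := ih z hz β hβ
    grind
  · have := ih' z hz
    grind

theorem Le.subs {α β : M} (hβ : IsOrd β) (h : Le α β) : Subs α β := by
  rcases h with rfl | h
  exacts [Subs.refl _, hβ.1 _ h]

theorem IsOrd.le_or_mem {α β : M} (hα : IsOrd α) (hβ : IsOrd β) : Le α β ∨ β ∈ₘ α := by
  rcases hα.trichotomy hβ with h | h | h
  exacts [.inl (.inr h), .inl (.inl h), .inr h]

theorem le_of_subs {α β : M} (hα : IsOrd α) (hβ : IsOrd β) (h : Subs α β) : Le α β :=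
  (hα.le_or_mem hβ).resolve_right fun h' => mem_irrefl _ (h _ h')

theorem not_mem_of_le {α β : M} (hβ : IsOrd β) (h : Le α β) : ¬ β ∈ₘ α :=
  fun h' => mem_irrefl _ (h.subs hβ _ h')

theorem Le.trans_mem {α β γ : M} (hγ : IsOrd γ) (h : Le α β) (h' : β ∈ₘ γ) : α ∈ₘ γ := by
  rcases h with rfl | h
  exacts [h', hγ.trans h' h]

theorem isOrd_emp : IsOrd (emp M) :=
  ⟨fun _ h => (not_mem_emp h).elim, fun _ h => (not_mem_emp h).elim⟩

theorem IsOrd.succ {α : M} (h : IsOrd α) : IsOrd (succ α) := by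
  refine ⟨fun y hy z hz => ?_, fun y hy => ?_⟩
  · rcases mem_succ.1 hy with hy | rfl
    exacts [mem_succ.2 (.inl (h.trans hy hz)), mem_succ.2 (.inl hz)]
  · rcases mem_succ.1 hy with hy | rfl
    exacts [h.2 y hy, h.1]

theorem mem_succ_iff_le {α β : M} : α ∈ₘ ChoicelessLS.succ β ↔ Le α β := by
  rw [mem_succ, Le, or_comm]

theorem succ_le_of_mem {α β : M} (hβ : IsOrd β) (h : α ∈ₘ β) : Le (ChoicelessLS.succ α) β := by
  refine le_of_subs (hβ.mem h).succ hβ fun z hz => ?_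
  rcases mem_succ.1 hz with hz | rfl
  exacts [hβ.trans h hz, h]

theorem isOrd_sUnion {x : M} (h : ∀ y, y ∈ₘ x → IsOrd y) : IsOrd (sUnion x) := by
  refine ⟨fun y hy z hz => ?_, fun y hy => ?_⟩
  · obtain ⟨t, ht, hyt⟩ := mem_sUnion.1 hy
    exact mem_sUnion.2 ⟨t, ht, (h t ht).trans hyt hz⟩
  · obtain ⟨t, ht, hyt⟩ := mem_sUnion.1 hy
    exact (h t ht).2 y hyt

theorem emp_mem {α : M} (hα : IsOrd α) (h : α ≠ emp M) : emp M ∈ₘ α := by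
  rcases isOrd_emp.trichotomy hα with h' | h' | h'
  exacts [h', (h h'.symm).elim, (not_mem_emp h').elim]

/-- A transitive set of ordinals is an ordinal. -/
theorem isOrd_of_trans {x : M} (h : IsTrans x) (h' : ∀ y, y ∈ₘ x → IsOrd y) : IsOrd x :=
  ⟨h, fun y hy => (h' y hy).1⟩

theorem isOrd_union {α β : M} (hα : IsOrd α) (hβ : IsOrd β) : IsOrd (union α β) := by
  refine isOrd_sUnion fun y hy => ?_
  rcases mem_upair.1 hy with rfl | rfl
  exacts [hα, hβ]

theorem union_eq_of_ord {α β : M} (hα : IsOrd α) (hβ : IsOrd β) :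
    union α β = α ∨ union α β = β := by
  rcases hα.le_or_mem hβ with h | h
  · exact .inr (ext fun z => by
      have := h.subs hβ z
      rw [mem_union]; tauto)
  · exact .inl (ext fun z => by
      have := hα.1 _ h z
      rw [mem_union]; tauto)

/-! ### The natural numbers -/

theorem exists_isOmega : ∃ w : M, IsOmega w := by
  obtain ⟨i, hi⟩ := (ZF.out : IsZFModel M).infinity
  obtain ⟨w, hw⟩ := sep i (fun n => ∀ j, IsInductive j → n ∈ₘ j)
  exact ⟨w, fun n => (hw n).trans ⟨fun h => h.2, fun h => ⟨h i hi, h⟩⟩⟩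

variable (M) in
/-- The ordinal `ω` of `M`. -/
noncomputable def om : M := (exists_isOmega (M := M)).choose

theorem isOmega_om : IsOmega (om M) := (exists_isOmega (M := M)).choose_spec

theorem isOmega_iff {w : M} : IsOmega w ↔ w = om M :=
  ⟨fun h => ext fun z => (h z).trans (isOmega_om z).symm, fun h => h ▸ isOmega_om⟩

theorem isInductive_iff {w : M} :
    IsInductive w ↔ emp M ∈ₘ w ∧ ∀ x, x ∈ₘ w → succ x ∈ₘ w := by
  simp [IsInductive, isEmptySet_iff, isSucc_iff]

theorem emp_mem_om : emp M ∈ₘ om M :=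
  (isOmega_om _).2 fun _ hi => (isInductive_iff.1 hi).1

theorem succ_mem_om {n : M} (h : n ∈ₘ om M) : succ n ∈ₘ om M :=
  (isOmega_om _).2 fun i hi => (isInductive_iff.1 hi).2 n ((isOmega_om n).1 h i hi)

theorem om_induction (P : M → Prop) [FO fun v : ℕ → M => P (v 0)] (h0 : P (emp M))
    (hs : ∀ n, n ∈ₘ om M → P n → P (succ n)) {n : M} (hn : n ∈ₘ om M) : P n := by
  obtain ⟨b, hb⟩ := sep (om M) P
  refine ((hb n).1 ((isOmega_om n).1 hn b (isInductive_iff.2 ⟨?_, fun x hx => ?_⟩))).2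
  · exact (hb _).2 ⟨emp_mem_om, h0⟩
  · rw [hb] at hx ⊢
    exact ⟨succ_mem_om hx.1, hs x hx.1 hx.2⟩

theorem isOrd_om : IsOrd (om M) := by
  have h1 : ∀ n : M, n ∈ₘ om M → IsOrd n := fun n hn =>
    om_induction IsOrd isOrd_emp (fun _ _ h => h.succ) hn
  refine isOrd_of_trans (fun n hn => ?_) h1
  refine om_induction (fun n => Subs n (om M)) (fun _ h => (not_mem_emp h).elim) ?_ hn
  intro n hn h z hz
  rcases mem_succ.1 hz with hz | rfl
  exacts [h z hz, hn]

variable (M) in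
/-- The numerals of `M`. -/
noncomputable def num : ℕ → M
  | 0 => emp M
  | k + 1 => succ (num k)

theorem isNumeral_iff {k : ℕ} {x : M} : IsNumeral k x ↔ x = num M k := by
  induction k generalizing x with
  | zero => exact isEmptySet_iff
  | succ k ih => simp [IsNumeral, num, ih, isSucc_iff]

theorem num_mem_om (k : ℕ) : num M k ∈ₘ om M := by
  induction k with
  | zero => exact emp_mem_om
  | succ k ih => exact succ_mem_om ih

theorem num_mem_num {j k : ℕ} (h : j < k) : num M j ∈ₘ num M k := by
  induction k with
  | zero => omega
  | succ k ih =>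
    rcases Nat.lt_succ_iff_lt_or_eq.1 h with h | rfl
    exacts [mem_succ.2 (.inl (ih h)), mem_succ_self _]

theorem num_injective {j k : ℕ} (h : num M j = num M k) : j = k := by
  rcases lt_trichotomy j k with h' | h' | h'
  · exact (mem_irrefl _ (h ▸ num_mem_num h')).elim
  · exact h'
  · exact (mem_irrefl _ (h ▸ num_mem_num h')).elim

/-! ### Recursion along a definable well-founded relation on a set -/

/-- `h` is the restriction of `F` to the `R`-predecessors of `w` in `W`. -/
def IsRestr (W : M) (R : M → M → Prop) (F w h : M) : Prop :=
  ∀ o, o ∈ₘ h ↔ ∃ p s, o = opair p s ∧ p ∈ₘ W ∧ R p w ∧ Val F p s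

/-- `p` obeys the recursion `z ∈ F(w) ↔ K w (F ↾ w) z` on a downward closed part of `W`. -/
def IsAttempt (W : M) (R : M → M → Prop) (K : M → M → M → Prop) (p : M) : Prop :=
  ∀ w t, Val p w t → w ∈ₘ W ∧ (∀ w', w' ∈ₘ W → R w' w → ∃ t', Val p w' t') ∧
    ∃ h, IsRestr W R p w h ∧ ∀ z, z ∈ₘ t ↔ K w h z

section

variable {W : M} {R : M → M → Prop} {K : M → M → M → Prop}
  [hR : FO fun v : ℕ → M => R (v 0) (v 1)]
  [hK : FO fun v : ℕ → M => K (v 0) (v 1) (v 2)]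

instance {t u w : (ℕ → M) → M} [DF t] [DF u] [DF w] :
    FO fun v => IsRestr W R (t v) (u v) (w v) := by
  have hR' := fun (t u : (ℕ → M) → M) [DF t] [DF u] => FO.subst₂ hR (t := t) (u := u)
  unfold IsRestr; infer_instance

instance {t : (ℕ → M) → M} [DF t] : FO fun v => IsAttempt W R K (t v) := by
  have hR' := fun (t u : (ℕ → M) → M) [DF t] [DF u] => FO.subst₂ hR (t := t) (u := u)
  have hK' := fun (t u w : (ℕ → M) → M) [DF t] [DF u] [DF w] =>
    FO.subst₃ hK (t := t) (u := u) (w := w)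
  unfold IsAttempt; infer_instance

theorem IsRestr.val_iff {F w h p s : M} (hh : IsRestr W R F w h) :
    Val h p s ↔ p ∈ₘ W ∧ R p w ∧ Val F p s := by
  rw [ChoicelessLS.val_iff, hh]
  constructor
  · rintro ⟨p', s', he, hp⟩
    obtain ⟨rfl, rfl⟩ := opair_inj.1 he
    exact hp
  · exact fun h => ⟨p, s, rfl, h⟩

omit hK in
theorem exists_isRestr (F w : M) : ∃ h, IsRestr W R F w h := by
  have hR' := fun (t u : (ℕ → M) → M) [DF t] [DF u] => FO.subst₂ hR (t := t) (u := u)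
  obtain ⟨h, hh⟩ := sep F (fun o => ∃ p s, o = opair p s ∧ p ∈ₘ W ∧ R p w ∧ Val F p s)
  refine ⟨h, fun o => (hh o).trans ⟨fun h => h.2, fun h => ⟨?_, h⟩⟩⟩
  obtain ⟨p, s, rfl, -, -, hv⟩ := h
  exact ChoicelessLS.val_iff.1 hv

/-- At an `R`-minimal disagreement the two attempts have the same restriction, because both domains
are closed under predecessors; hence they have the same value there. -/
theorem IsAttempt.unique (wf : ∀ Z, Subs Z W → (∃ w, w ∈ₘ Z) → ∃ w, w ∈ₘ Z ∧
    ∀ w', w' ∈ₘ Z → ¬ R w' w) {p p' w t t' : M} (hp : IsAttempt W R K p)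
    (hp' : IsAttempt W R K p') (ht : Val p w t) (ht' : Val p' w t') : t = t' := by
  by_contra hne
  obtain ⟨Z, hZ⟩ := sep W (fun w => ∃ t t', t ≠ t' ∧ Val p w t ∧ Val p' w t')
  obtain ⟨w, hw, hm⟩ := wf Z (fun z hz => ((hZ z).1 hz).1)
    ⟨w, (hZ w).2 ⟨(hp w t ht).1, t, t', hne, ht, ht'⟩⟩
  obtain ⟨-, t, t', hne, ht, ht'⟩ := (hZ w).1 hw
  obtain ⟨-, hc, h, hr, hh⟩ := hp w t ht
  obtain ⟨-, hc', h', hr', hh'⟩ := hp' w t' ht'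
  have key : ∀ q s s', q ∈ₘ W → R q w → Val p q s → Val p' q s' → s = s' := by
    intro q s s' hq hqw hs hs'
    by_contra hne'
    exact hm q ((hZ q).2 ⟨hq, s, s', hne', hs, hs'⟩) hqw
  have : h = h' := by
    refine ext fun o => ?_
    rw [hr, hr']
    refine exists_congr fun q => exists_congr fun s => and_congr_right fun _ =>
      and_congr_right fun hq => and_congr_right fun hqw => ⟨fun hv => ?_, fun hv => ?_⟩
    · obtain ⟨s', hs'⟩ := hc' q hq hqw
      rwa [key q s s' hq hqw hv hs']
    · obtain ⟨s', hs'⟩ := hc q hq hqw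
      rwa [← key q s' s hq hqw hs' hv]
  subst this
  exact hne (ext fun z => (hh z).trans (hh' z).symm)

/-- `F` is the union of all attempts. If it were undefined somewhere, it would be extendable at an
`R`-minimal such point. `hKs` guarantees that the prescribed value is a set. `R` need not be
transitive. -/
theorem exists_rec (W : M) (R : M → M → Prop) (K : M → M → M → Prop)
    [hR : FO fun v : ℕ → M => R (v 0) (v 1)]
    [hK : FO fun v : ℕ → M => K (v 0) (v 1) (v 2)]
    (wf : ∀ Z, Subs Z W → (∃ w, w ∈ₘ Z) → ∃ w, w ∈ₘ Z ∧ ∀ w', w' ∈ₘ Z → ¬ R w' w)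
    (hKs : ∀ w h, ∃ t, ∀ z, z ∈ₘ t ↔ K w h z) :
    ∃ F, IsFun F W ∧ ∀ w t, Val F w t →
      ∃ h, (∀ p s, Val h p s ↔ p ∈ₘ W ∧ R p w ∧ Val F p s) ∧ ∀ z, z ∈ₘ t ↔ K w h z := by
  obtain ⟨F, hF1, hF⟩ := exists_partial W (fun w t => ∃ p, IsAttempt W R K p ∧ Val p w t) (by
    rintro w - t t' ⟨p, hp, hv⟩ ⟨p', hp', hv'⟩
    exact hp.unique wf hp' hv hv')
  have attempt_restr : ∀ p w t, IsAttempt W R K p → Val p w t →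
      ∀ h, IsRestr W R p w h → IsRestr W R F w h := by
    intro p w t hp hv h hh o
    rw [hh]
    refine exists_congr fun q => exists_congr fun s => and_congr_right fun _ =>
      and_congr_right fun hq => and_congr_right fun hqw => ?_
    rw [hF]
    refine ⟨fun hv => ⟨hq, p, hp, hv⟩, ?_⟩
    rintro ⟨-, p', hp', hv'⟩
    obtain ⟨s', hs'⟩ := (hp w t hv).2.1 q hq hqw
    rwa [hp'.unique wf hp hv' hs']
  have hFa : ∀ w t, Val F w t → (∀ w', w' ∈ₘ W → R w' w → ∃ t', Val F w' t') ∧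
      ∃ h, IsRestr W R F w h ∧ ∀ z, z ∈ₘ t ↔ K w h z := by
    intro w t hv
    obtain ⟨-, p, hp, hv'⟩ := (hF w t).1 hv
    obtain ⟨-, h2, h, h3, h4⟩ := hp w t hv'
    refine ⟨fun w' hw' hR' => ?_, h, attempt_restr p w t hp hv' h h3, h4⟩
    obtain ⟨t', ht'⟩ := h2 w' hw' hR'
    exact ⟨t', (hF _ _).2 ⟨hw', p, hp, ht'⟩⟩
  have total : ∀ w, w ∈ₘ W → ∃ t, Val F w t := by
    by_contra hc
    push Not at hc
    obtain ⟨w, hw, hn⟩ := hc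
    obtain ⟨Z, hZ⟩ := sep W (fun w => ∀ t, ¬ Val F w t)
    obtain ⟨w, hw, hm⟩ := wf Z (fun z hz => ((hZ z).1 hz).1) ⟨w, (hZ w).2 ⟨hw, hn⟩⟩
    rw [hZ] at hw
    obtain ⟨h, hh⟩ := exists_isRestr (W := W) (R := R) F w
    obtain ⟨t, ht⟩ := hKs w h
    have hG : ∀ x y, Val (union F (upair (opair w t) (opair w t))) x y ↔
        Val F x y ∨ (x = w ∧ y = t) := by
      intro x y
      rw [val_iff, mem_union, ← val_iff, mem_upair, or_self, opair_inj]
    refine hw.2 t ((hF w t).2 ⟨hw.1, union F (upair (opair w t) (opair w t)), ?_,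
      (hG w t).2 (.inr ⟨rfl, rfl⟩)⟩)
    have hww : ¬ R w w := hm w ((hZ w).2 hw)
    -- The domain of `F` is closed under predecessors and omits `w`, so adjoining `(w, t)` changes
    -- no restriction below a point of that domain.
    have hFw : ∀ x s, Val F x s → ¬ R w x := by
      intro x s hv hR'
      obtain ⟨t', ht'⟩ := (hFa x s hv).1 w hw.1 hR'
      exact hw.2 t' ht'
    have hrestr : ∀ x h, ¬ R w x → IsRestr W R F x h →
        IsRestr W R (union F (upair (opair w t) (opair w t))) x h := by
      intro x h hx hh o
      rw [hh]
      refine exists_congr fun q => exists_congr fun s => and_congr_right fun _ =>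
        and_congr_right fun hq => and_congr_right fun hqx => ?_
      rw [hG]
      refine ⟨.inl, fun h => h.resolve_right ?_⟩
      rintro ⟨rfl, -⟩
      exact hx hqx
    intro x y hv
    rcases (hG x y).1 hv with hv | ⟨rfl, rfl⟩
    · obtain ⟨h1, h', h2, h3⟩ := hFa x y hv
      refine ⟨((hF x y).1 hv).1, fun w' hw' hR' => ?_, h', hrestr x h' (hFw x y hv) h2, h3⟩
      obtain ⟨t', ht'⟩ := h1 w' hw' hR'
      exact ⟨t', (hG _ _).2 (.inl ht')⟩
    · refine ⟨hw.1, fun w' hw' hR' => ?_, h, hrestr x h hww hh, ht⟩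
      by_contra hc
      push Not at hc
      exact hm w' ((hZ w').2 ⟨hw', fun t' ht' => hc t' ((hG _ _).2 (.inl ht'))⟩) hR'
  refine ⟨F, ⟨hF1, fun w hw => ?_⟩, fun w t hv => ?_⟩
  · obtain ⟨t, ht⟩ := total w hw
    refine ⟨t, ht, fun t' ht' => ?_⟩
    obtain ⟨-, p, hp, hv⟩ := (hF w t).1 ht
    obtain ⟨-, p', hp', hv'⟩ := (hF w t').1 ht'
    exact hp'.unique wf hp hv' hv
  · obtain ⟨-, h, hr, hh⟩ := hFa w t hv
    exact ⟨h, fun p s => hr.val_iff, hh⟩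

end

theorem mem_wf (W Z : M) (_ : Subs Z W) (h : ∃ w, w ∈ₘ Z) :
    ∃ w, w ∈ₘ Z ∧ ∀ w', w' ∈ₘ Z → ¬ w' ∈ₘ w :=
  exists_minimal h

/-! ### Transitive closure and induction on membership -/

/-- The recursion on `ω` sets `F(n) = x ∪ ⋃ {⋃ F(m) | m < n}`; elements of elements of `F(n)` land
in `F(n + 1)`. -/
theorem exists_trans_superset (x : M) : ∃ T, IsTrans T ∧ Subs x T := by
  obtain ⟨F, hF, hrec⟩ := exists_rec (om M) Mem
    (fun _ h z => z ∈ₘ x ∨ ∃ m t u, Val h m t ∧ u ∈ₘ t ∧ z ∈ₘ u) (mem_wf _) (by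
      intro w h
      obtain ⟨r, hr⟩ := exists_range h
      refine ⟨union x (sUnion (sUnion r)), fun z => ?_⟩
      simp only [mem_union, mem_sUnion, hr]
      grind)
  obtain ⟨r, hr⟩ := exists_range F
  refine ⟨sUnion r, fun y hy z hz => ?_, fun y hy => ?_⟩
  · obtain ⟨t, ht, hyt⟩ := mem_sUnion.1 hy
    obtain ⟨n, hn⟩ := (hr t).1 ht
    have hno := hF.mem_dom hn
    obtain ⟨s, hs⟩ := hF.exists_val (succ_mem_om hno)
    refine mem_sUnion.2 ⟨s, (hr s).2 ⟨_, hs⟩, ?_⟩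
    obtain ⟨h, hh, hz'⟩ := hrec _ _ hs
    exact (hz' z).2 (.inr ⟨n, t, y, (hh n t).2 ⟨hno, mem_succ_self n, hn⟩, hyt, hz⟩)
  · obtain ⟨s, hs⟩ := hF.exists_val (emp_mem_om (M := M))
    refine mem_sUnion.2 ⟨s, (hr s).2 ⟨_, hs⟩, ?_⟩
    obtain ⟨h, hh, hz'⟩ := hrec _ _ hs
    exact (hz' y).2 (.inl hy)

theorem mem_induction (P : M → Prop) [FO fun v : ℕ → M => P (v 0)]
    (h : ∀ x, (∀ y, y ∈ₘ x → P y) → P x) (x : M) : P x := by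
  obtain ⟨T, hT, hx⟩ := exists_trans_superset x
  by_contra hP
  obtain ⟨b, hb⟩ := sep T (fun y => ¬ P y)
  by_cases hne : ∃ y, y ∈ₘ b
  · obtain ⟨y, hy, hm⟩ := exists_minimal hne
    rw [hb] at hy
    refine hy.2 (h y fun z hz => ?_)
    by_contra hz'
    exact hm z ((hb z).2 ⟨hT y hy.1 z hz, hz'⟩) hz
  · refine hP (h x fun z hz => ?_)
    by_contra hz'
    exact hne ⟨z, (hb z).2 ⟨hx z hz, hz'⟩⟩

/-! ### The collapse of a well-founded relation -/

theorem exists_collapse (W : M) (R : M → M → Prop)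
    [hR : FO fun v : ℕ → M => R (v 0) (v 1)]
    (wf : ∀ Z, Subs Z W → (∃ w, w ∈ₘ Z) → ∃ w, w ∈ₘ Z ∧ ∀ w', w' ∈ₘ Z → ¬ R w' w) :
    ∃ F, IsFun F W ∧ ∀ w t, Val F w t →
      ∀ z, z ∈ₘ t ↔ ∃ y, y ∈ₘ W ∧ R y w ∧ Val F y z := by
  obtain ⟨F, hF, hrec⟩ := exists_rec W R (fun _ h z => ∃ y, Val h y z) wf (by
    intro w h
    exact exists_range h)
  refine ⟨F, hF, fun w t hv z => ?_⟩
  obtain ⟨h, hh, hz⟩ := hrec w t hv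
  rw [hz]
  exact exists_congr fun y => hh y z

/-- `F` is the collapse of the relation `R` on `W`. -/
structure Collapses (F W : M) (R : M → M → Prop) : Prop where
  isFun : IsFun F W
  mem_iff : ∀ {w t}, Val F w t → ∀ {z}, z ∈ₘ t ↔ ∃ y, y ∈ₘ W ∧ R y w ∧ Val F y z

theorem Collapses.mem {F W x y s t : M} {R : M → M → Prop} (h : Collapses F W R)
    (hs : Val F x s) (ht : Val F y t) (hR : R x y) : s ∈ₘ t :=
  (h.mem_iff ht).2 ⟨x, h.isFun.mem_dom hs, hR, hs⟩

theorem Collapses.eq_of_val {F W x y t : M} {R : M → M → Prop} (h : Collapses F W R)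
    (tri : R x y ∨ x = y ∨ R y x) (hx : Val F x t) (hy : Val F y t) : x = y := by
  rcases tri with hR | hR | hR
  · exact (mem_irrefl _ (h.mem hx hy hR)).elim
  · exact hR
  · exact (mem_irrefl _ (h.mem hy hx hR)).elim

/-- Transitivity of `R` makes every value a transitive set, and elements of values are values. -/
theorem Collapses.isOrd {F W w t : M} {R : M → M → Prop} (h : Collapses F W R)
    (tr : ∀ x y z, x ∈ₘ W → y ∈ₘ W → z ∈ₘ W → R x y → R y z → R x z) (hw : Val F w t) :
    IsOrd t := by
  have ht : ∀ {w t}, Val F w t → IsTrans t := by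
    intro w t hw y hy z hz
    obtain ⟨a, ha, haw, hay⟩ := (h.mem_iff hw).1 hy
    obtain ⟨b, hb, hba, hbz⟩ := (h.mem_iff hay).1 hz
    exact (h.mem_iff hw).2 ⟨b, hb, tr b a w hb ha (h.isFun.mem_dom hw) hba haw, hbz⟩
  refine ⟨ht hw, fun y hy => ?_⟩
  obtain ⟨a, -, -, hay⟩ := (h.mem_iff hw).1 hy
  exact ht hay

theorem Collapses.of_mem {F W w t z : M} {R : M → M → Prop} (h : Collapses F W R)
    (hw : Val F w t) (hz : z ∈ₘ t) : ∃ y, R y w ∧ Val F y z := by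
  obtain ⟨y, -, hR, hy⟩ := (h.mem_iff hw).1 hz
  exact ⟨y, hR, hy⟩

/-! ### The cumulative hierarchy -/

theorem exists_isV {α : M} (hα : IsOrd α) : ∃ v, IsV α v := by
  obtain ⟨F, hF, hrec⟩ := exists_rec (succ α) Mem (fun _ h z => ∃ γ t, Val h γ t ∧ Subs z t)
    (mem_wf _) (by
      intro w h
      obtain ⟨r, hr⟩ := exists_range h
      obtain ⟨b, hb⟩ := sep (pow (sUnion r)) (fun z => ∃ γ t, Val h γ t ∧ Subs z t)
      refine ⟨b, fun z => (hb z).trans ⟨fun h => h.2, fun h => ⟨?_, h⟩⟩⟩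
      obtain ⟨γ, t, hγ, hz⟩ := h
      exact mem_pow.2 fun y hy => mem_sUnion.2 ⟨t, (hr t).2 ⟨γ, hγ⟩, hz y hy⟩)
  obtain ⟨v, hv⟩ := hF.exists_val (mem_succ_self α)
  refine ⟨v, hα, succ α, F, isSucc_iff.2 rfl, hF, fun β u hu z => ?_, hv⟩
  obtain ⟨h, hh, hz⟩ := hrec β u hu
  rw [hz]
  refine exists_congr fun γ => exists_congr fun t => ?_
  rw [hh]
  exact ⟨fun h => ⟨h.1.2.1, h.1.2.2, h.2⟩, fun h => ⟨⟨hF.mem_dom h.2.1, h.1, h.2.1⟩, h.2.2⟩⟩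

/-- Cutting the witnessing function down to `succ γ` keeps the recursion valid, so its intermediate
values are genuine levels of the hierarchy. -/
theorem isV_of_val {α f γ t : M} (hα : IsOrd α) (hf : IsFun f (succ α))
    (hrec : ∀ β u, Val f β u → ∀ z, z ∈ₘ u ↔ ∃ γ t, γ ∈ₘ β ∧ Val f γ t ∧ Subs z t)
    (ht : Val f γ t) : IsV γ t := by
  have hγ := hf.mem_dom ht
  have hγo : IsOrd γ := hα.succ.mem hγ
  have hdom : ∀ β, β ∈ₘ succ γ → β ∈ₘ succ α := fun β hβ => by
    rcases mem_succ.1 hβ with h | rfl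
    exacts [hα.succ.trans hγ h, hγ]
  obtain ⟨g, hg, hgv⟩ := exists_fun (succ γ) (Val f) (fun β hβ => hf.exists_val (hdom β hβ))
    fun _ _ _ _ => hf.unique
  refine ⟨hγo, succ γ, g, isSucc_iff.2 rfl, hg, fun β u hu z => ?_,
    (hgv _ _).2 ⟨mem_succ_self γ, ht⟩⟩
  rw [hgv] at hu
  rw [hrec β u hu.2]
  refine exists_congr fun δ => exists_congr fun s => and_congr_right fun hδ =>
    and_congr_left fun _ => ?_
  rw [hgv]
  exact ⟨fun h => ⟨hγo.succ.trans hu.1 hδ, h⟩, fun h => h.2⟩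

theorem IsV.exists_rec {α v : M} (h : IsV α v) {z : M} :
    z ∈ₘ v → ∃ γ t, γ ∈ₘ α ∧ IsV γ t ∧ Subs z t := by
  obtain ⟨hα, s, f, hs, hf, hrec, hv⟩ := h
  obtain rfl := isSucc_iff.1 hs
  rw [hrec _ _ hv]
  rintro ⟨γ, t, hγ, ht, hz⟩
  exact ⟨γ, t, hγ, isV_of_val hα hf hrec ht, hz⟩

theorem IsV.unique {α v v' : M} (h : IsV α v) (h' : IsV α v') : v = v' := by
  refine ord_induction (fun α => ∀ v v', IsV α v → IsV α v' → v = v') ?_ h.1 v v' h h'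
  intro α hα ih v v' h h'
  have key : ∀ v v', IsV α v → IsV α v' → Subs v v' := by
    intro v v' h h' z hz
    obtain ⟨γ, t, hγ, ht, hzt⟩ := h.exists_rec hz
    obtain ⟨-, s, f, hs, hf, hrec, hv⟩ := h'
    obtain rfl := isSucc_iff.1 hs
    obtain ⟨t', ht'⟩ := hf.exists_val (mem_succ.2 (.inl hγ))
    obtain rfl := ih γ hγ t t' ht (isV_of_val hα hf hrec ht')
    exact (hrec _ _ hv z).2 ⟨γ, t, hγ, ht', hzt⟩
  exact (key v v' h h').antisymm (key v' v h' h)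

theorem IsV.mem_iff {α v z : M} (h : IsV α v) :
    z ∈ₘ v ↔ ∃ γ t, γ ∈ₘ α ∧ IsV γ t ∧ Subs z t := by
  refine ⟨h.exists_rec, ?_⟩
  rintro ⟨γ, t, hγ, ht, hz⟩
  obtain ⟨hα, s, f, hs, hf, hrec, hv⟩ := h
  obtain rfl := isSucc_iff.1 hs
  obtain ⟨t', ht'⟩ := hf.exists_val (mem_succ.2 (.inl hγ))
  obtain rfl := ht.unique (isV_of_val hα hf hrec ht')
  exact (hrec _ _ hv z).2 ⟨γ, t, hγ, ht', hz⟩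

open Classical in
/-- The set `V_α` (the empty set when `α` is not an ordinal). -/
noncomputable def V (α : M) : M := if h : IsOrd α then (exists_isV h).choose else emp M

theorem isV_V {α : M} (h : IsOrd α) : IsV α (V α) := by
  rw [V, dif_pos h]
  exact (exists_isV h).choose_spec

theorem isV_iff {α v : M} (h : IsOrd α) : IsV α v ↔ v = V α :=
  ⟨fun hv => hv.unique (isV_V h), fun hv => hv ▸ isV_V h⟩

instance {t : (ℕ → M) → M} [DF t] : DF fun v => V (t v) :=
  ⟨FO.congr (P := fun v => IsV (t (tl v)) (v 0) ∨ (¬ IsOrd (t (tl v)) ∧ v 0 = emp M))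
    inferInstance fun v => by
      by_cases h : IsOrd (t (tl v))
      · simp [h, isV_iff h]
      · have h' : ¬ IsV (t (tl v)) (v 0) := fun h' => h h'.1
        rw [V, dif_neg h]
        tauto⟩

theorem mem_V {α z : M} (h : IsOrd α) : z ∈ₘ V α ↔ ∃ γ, γ ∈ₘ α ∧ Subs z (V γ) := by
  rw [(isV_V h).mem_iff]
  constructor
  · rintro ⟨γ, t, hγ, ht, hz⟩
    rw [isV_iff (h.mem hγ)] at ht
    exact ⟨γ, hγ, ht ▸ hz⟩
  · rintro ⟨γ, hγ, hz⟩
    exact ⟨γ, V γ, hγ, isV_V (h.mem hγ), hz⟩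

theorem V_mono {α β : M} (hα : IsOrd α) (hβ : IsOrd β) (h : Subs α β) : Subs (V α) (V β) := by
  intro z hz
  obtain ⟨γ, hγ, hz⟩ := (mem_V hα).1 hz
  exact (mem_V hβ).2 ⟨γ, h γ hγ, hz⟩

theorem isTrans_V {α : M} (hα : IsOrd α) : IsTrans (V α) := by
  intro z hz
  obtain ⟨γ, hγ, hz⟩ := (mem_V hα).1 hz
  exact hz.trans (V_mono (hα.mem hγ) hα (hα.1 γ hγ))

theorem mem_V_succ {α z : M} (hα : IsOrd α) : z ∈ₘ V (succ α) ↔ Subs z (V α) := by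
  rw [mem_V hα.succ]
  constructor
  · rintro ⟨γ, hγ, hz⟩
    have := mem_succ_iff_le.1 hγ
    exact hz.trans (V_mono (hα.succ.mem hγ) hα (this.subs hα))
  · exact fun h => ⟨α, mem_succ_self α, h⟩

theorem subs_V {α : M} (hα : IsOrd α) : Subs α (V α) :=
  ord_induction (fun α => Subs α (V α)) (fun _ hα ih β hβ => (mem_V hα).2 ⟨β, hβ, ih β hβ⟩) hα

theorem not_mem_V {α : M} (hα : IsOrd α) : ¬ α ∈ₘ V α := by
  refine ord_induction (fun α => ¬ α ∈ₘ V α) (fun α hα ih h => ?_) hα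
  obtain ⟨γ, hγ, hz⟩ := (mem_V hα).1 h
  exact ih γ hγ (hz γ hγ)

theorem mem_V_of_mem {α β : M} (hα : IsOrd α) (h : β ∈ₘ α) : β ∈ₘ V α := subs_V hα β h

/-- Replacement needs a functional relation, so each element of `x` is sent to the least level
containing it; the level after the supremum contains `x`. -/
theorem exists_mem_V (x : M) : ∃ α, IsOrd α ∧ x ∈ₘ V α := by
  refine mem_induction (fun x => ∃ α, IsOrd α ∧ x ∈ₘ V α) (fun x ih => ?_) x
  have hex : ∀ y, y ∈ₘ x → ∃ α, IsOrd α ∧ y ∈ₘ V α ∧ ∀ β, β ∈ₘ α → ¬ y ∈ₘ V β := by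
    intro y hy
    obtain ⟨α, hα, hyα⟩ := ih y hy
    obtain ⟨β, hβ, h1, -, h2⟩ := ord_min (fun α => y ∈ₘ V α) hα hyα
    exact ⟨β, hβ, h1, h2⟩
  obtain ⟨A, hA⟩ := repl x
    (fun y α => IsOrd α ∧ y ∈ₘ V α ∧ ∀ β, β ∈ₘ α → ¬ y ∈ₘ V β) (by
      rintro y - α α' ⟨h1, h2, h3⟩ ⟨h1', h2', h3'⟩
      rcases h1.trichotomy h1' with h | h | h
      exacts [(h3' _ h h2).elim, h, (h3 _ h h2').elim])
  have hAo : IsOrd (sUnion A) := isOrd_sUnion fun α hα => by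
    obtain ⟨y, -, h, -⟩ := (hA α).1 hα
    exact h
  refine ⟨succ (sUnion A), hAo.succ, (mem_V_succ hAo).2 fun y hy => ?_⟩
  obtain ⟨α, h1, h2, h3⟩ := hex y hy
  have hαA : α ∈ₘ A := (hA α).2 ⟨y, hy, h1, h2, h3⟩
  exact V_mono h1 hAo (fun z hz => mem_sUnion.2 ⟨α, hαA, hz⟩) y h2

/-- `κ` is closed under successor. -/
def IsLimit (κ : M) : Prop := IsOrd κ ∧ ∀ β, β ∈ₘ κ → succ β ∈ₘ κ

theorem isLimit_om : IsLimit (om M) := ⟨isOrd_om, fun _ => succ_mem_om⟩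

theorem IsLimit.upair {κ x y : M} (h : IsLimit κ) (hx : x ∈ₘ V κ) (hy : y ∈ₘ V κ) :
    upair x y ∈ₘ V κ := by
  obtain ⟨α, hα, hx⟩ := (mem_V h.1).1 hx
  obtain ⟨β, hβ, hy⟩ := (mem_V h.1).1 hy
  have hαo := h.1.mem hα
  have hβo := h.1.mem hβ
  have hγ : union α β ∈ₘ κ := by
    rcases union_eq_of_ord hαo hβo with e | e <;> rw [e] <;> assumption
  have hγo := h.1.mem hγ
  refine (mem_V h.1).2 ⟨succ (union α β), h.2 _ hγ, fun z hz => (mem_V_succ hγo).2 ?_⟩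
  rcases mem_upair.1 hz with rfl | rfl
  · exact hx.trans (V_mono hαo hγo fun u hu => mem_union.2 (.inl hu))
  · exact hy.trans (V_mono hβo hγo fun u hu => mem_union.2 (.inr hu))

theorem IsLimit.opair {κ x y : M} (h : IsLimit κ) (hx : x ∈ₘ V κ) (hy : y ∈ₘ V κ) :
    opair x y ∈ₘ V κ := h.upair (h.upair hx hx) (h.upair hx hy)

theorem opair_mem_V_succ {α x y : M} (hα : IsOrd α) (hx : x ∈ₘ V α) (hy : y ∈ₘ V α) :
    opair x y ∈ₘ V (succ (succ α)) := by
  refine (mem_V_succ hα.succ).2 fun z hz => (mem_V_succ hα).2 fun u hu => ?_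
  rcases mem_upair.1 hz with rfl | rfl <;> rcases mem_upair.1 hu with rfl | rfl <;> assumption

theorem IsLimit.prod_ord {κ β : M} (h : IsLimit κ) (hβ : β ∈ₘ κ) : prod β β ∈ₘ V κ := by
  have hβo := h.1.mem hβ
  refine (mem_V h.1).2 ⟨succ (succ β), h.2 _ (h.2 _ hβ), fun z hz => ?_⟩
  obtain ⟨x, y, hx, hy, rfl⟩ := mem_prod.1 hz
  exact opair_mem_V_succ hβo (mem_V_of_mem hβo hx) (mem_V_of_mem hβo hy)

/-! ### Codes of formulas -/

/-- `(k, (a, b))`. -/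
noncomputable def code (k : ℕ) (a b : M) : M := opair (num M k) (opair a b)

theorem isCode_iff {k : ℕ} {c a b : M} : IsCode k c a b ↔ c = code k a b := by
  simp [IsCode, isNumeral_iff, isOPair_iff, code]

theorem code_inj {k l : ℕ} {a b c d : M} : code k a b = code l c d ↔ k = l ∧ a = c ∧ b = d := by
  rw [code, code, opair_inj, opair_inj]
  exact and_congr_left fun _ => ⟨num_injective, fun h => by rw [h]⟩

instance {k : ℕ} {t u : (ℕ → M) → M} [DF t] [DF u] : DF fun v => code k (t v) (u v) := by
  unfold code; infer_instance

theorem isFormulaClosed_iff {F : M} : IsFormulaClosed F ↔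
    (∀ i j, i ∈ₘ om M → j ∈ₘ om M → code 0 i j ∈ₘ F) ∧
    (∀ i j, i ∈ₘ om M → j ∈ₘ om M → code 1 i j ∈ₘ F) ∧
    code 2 (emp M) (emp M) ∈ₘ F ∧
    (∀ p q, p ∈ₘ F → q ∈ₘ F → code 3 p q ∈ₘ F) ∧
    (∀ i p, i ∈ₘ om M → p ∈ₘ F → code 4 i p ∈ₘ F) := by
  simp only [IsFormulaClosed, isOmega_iff, forall_eq, IsMemCode, IsEqCode, IsFalsumCode, IsImpCode,
    IsAllCode, isCode_iff, isEmptySet_iff, exists_eq_left]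
  exact and_congr ⟨fun h i j hi hj => h _ i j hi hj rfl, fun h c i j hi hj e => e ▸ h i j hi hj⟩
    (and_congr ⟨fun h i j hi hj => h _ i j hi hj rfl, fun h c i j hi hj e => e ▸ h i j hi hj⟩
    (and_congr Iff.rfl (and_congr
      ⟨fun h i j hi hj => h _ i j hi hj rfl, fun h c i j hi hj e => e ▸ h i j hi hj⟩
      ⟨fun h i j hi hj => h _ i j hi hj rfl, fun h c i j hi hj e => e ▸ h i j hi hj⟩)))

theorem isFormulaClosed_V_om : IsFormulaClosed (V (om M)) := by
  have hn : ∀ n : M, n ∈ₘ om M → n ∈ₘ V (om M) := fun n => mem_V_of_mem isOrd_om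
  have hc : ∀ (k : ℕ) (a b : M), a ∈ₘ V (om M) → b ∈ₘ V (om M) → code k a b ∈ₘ V (om M) :=
    fun k a b ha hb => isLimit_om.opair (hn _ (num_mem_om k)) (isLimit_om.opair ha hb)
  exact isFormulaClosed_iff.2 ⟨fun i j hi hj => hc _ _ _ (hn i hi) (hn j hj),
    fun i j hi hj => hc _ _ _ (hn i hi) (hn j hj), hc _ _ _ (hn _ emp_mem_om) (hn _ emp_mem_om),
    fun p q => hc _ _ _, fun i p hi hp => hc _ _ _ (hn i hi) hp⟩

theorem exists_formulaSet : ∃ F : M, ∀ c, c ∈ₘ F ↔ IsFormula c := by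
  obtain ⟨F, hF⟩ := sep (V (om M)) (fun c => IsFormula c)
  exact ⟨F, fun c => (hF c).trans ⟨fun h => h.2, fun h => ⟨h _ isFormulaClosed_V_om, h⟩⟩⟩

variable (M) in
/-- The set of codes of formulas. -/
noncomputable def formulaSet : M := (exists_formulaSet (M := M)).choose

theorem mem_formulaSet {c : M} : c ∈ₘ formulaSet M ↔ IsFormula c :=
  (exists_formulaSet (M := M)).choose_spec c

theorem isFormulaClosed_formulaSet : IsFormulaClosed (formulaSet M) := by
  simp only [isFormulaClosed_iff, mem_formulaSet, IsFormula]
  refine ⟨?_, ?_, ?_, ?_, ?_⟩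
  · exact fun i j hi hj F hF => hF.1 i j hi hj
  · exact fun i j hi hj F hF => hF.2.1 i j hi hj
  · exact fun F hF => hF.2.2.1
  · exact fun p q hp hq F hF => hF.2.2.2.1 p q (hp F hF) (hq F hF)
  · exact fun i p hi hp F hF => hF.2.2.2.2 i p hi (hp F hF)

/-- `p` is an immediate subformula of `c`. -/
def ImmSub (p c : M) : Prop :=
  (∃ q, c = code 3 p q) ∨ (∃ q, c = code 3 q p) ∨ ∃ i, c = code 4 i p

instance {t u : (ℕ → M) → M} [DF t] [DF u] : FO fun v => ImmSub (t v) (u v) := by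
  unfold ImmSub; infer_instance

/-- If `Z` had no minimal element, the formulas outside `Z` would be closed under the formation
rules, hence would be all formulas, and `Z` would be empty. -/
theorem immSub_wf (Z : M) (hZ : Subs Z (formulaSet M)) (h : ∃ w, w ∈ₘ Z) :
    ∃ w, w ∈ₘ Z ∧ ∀ w', w' ∈ₘ Z → ¬ ImmSub w' w := by
  by_contra hc
  push Not at hc
  obtain ⟨F, hF⟩ := sep (formulaSet M) (fun c => ¬ c ∈ₘ Z)
  have cl := isFormulaClosed_iff.1 (isFormulaClosed_formulaSet (M := M))
  obtain ⟨w, hw⟩ := h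
  have hwF : w ∈ₘ F := by
    refine mem_formulaSet.1 (hZ w hw) F (isFormulaClosed_iff.2 ⟨?_, ?_, ?_, ?_, ?_⟩)
    · refine fun i j hi hj => (hF _).2 ⟨cl.1 i j hi hj, fun hm => ?_⟩
      obtain ⟨p, -, hp⟩ := hc _ hm
      simp [ImmSub, code_inj] at hp
    · refine fun i j hi hj => (hF _).2 ⟨cl.2.1 i j hi hj, fun hm => ?_⟩
      obtain ⟨p, -, hp⟩ := hc _ hm
      simp [ImmSub, code_inj] at hp
    · refine (hF _).2 ⟨cl.2.2.1, fun hm => ?_⟩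
      obtain ⟨p, -, hp⟩ := hc _ hm
      simp [ImmSub, code_inj] at hp
    · refine fun p q hp hq => (hF _).2 ⟨cl.2.2.2.1 p q ((hF p).1 hp).1 ((hF q).1 hq).1,
        fun hm => ?_⟩
      obtain ⟨r, hr, hs⟩ := hc _ hm
      simp [ImmSub, code_inj] at hs
      rcases hs with rfl | rfl
      exacts [((hF _).1 hp).2 hr, ((hF _).1 hq).2 hr]
    · refine fun i p hi hp => (hF _).2 ⟨cl.2.2.2.2 i p hi ((hF p).1 hp).1, fun hm => ?_⟩
      obtain ⟨r, hr, hs⟩ := hc _ hm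
      simp [ImmSub, code_inj] at hs
      subst hs
      exact ((hF _).1 hp).2 hr
  exact ((hF w).1 hwF).2 hw

/-! ### Satisfaction -/

theorem isAssignment_iff {s A : M} : IsAssignment s A ↔ MapsInto s (om M) A := by
  simp [IsAssignment, isOmega_iff]

theorem exists_assignmentSet (A : M) : ∃ B, ∀ s, s ∈ₘ B ↔ IsAssignment s A := by
  obtain ⟨B, hB⟩ := sep (pow (prod (om M) A)) (fun s => IsAssignment s A)
  refine ⟨B, fun s => (hB s).trans ⟨fun h => h.2, fun h => ⟨mem_pow.2 fun p hp => ?_, h⟩⟩⟩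
  rw [isAssignment_iff] at h
  obtain ⟨x, y, hx, hxy⟩ := h.1.1 p hp
  rw [isOPair_iff] at hxy
  subst hxy
  exact opair_mem_prod.2 ⟨hx, h.2 x y (val_iff.2 hp)⟩

/-- One step of the recursive definition of satisfaction in `A`. -/
def SatStep (A c h s : M) : Prop :=
  IsAssignment s A ∧
    ((∃ i j, c = code 0 i j ∧ ∃ x y, Val s i x ∧ Val s j y ∧ x ∈ₘ y) ∨
    (∃ i j, c = code 1 i j ∧ ∃ x, Val s i x ∧ Val s j x) ∨
    (∃ p q, c = code 3 p q ∧ ((∃ t, Val h p t ∧ s ∈ₘ t) → ∃ t, Val h q t ∧ s ∈ₘ t)) ∨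
    ∃ i p, c = code 4 i p ∧ ∀ a s', a ∈ₘ A → IsAssignment s' A → IsUpdate s' s i a →
      ∃ t, Val h p t ∧ s' ∈ₘ t)

instance {A : M} {t u w : (ℕ → M) → M} [DF t] [DF u] [DF w] :
    FO fun v => SatStep A (t v) (u v) (w v) := by
  unfold SatStep; infer_instance

/-- Recursion on subformulas, the value at a code being the set of assignments that satisfy it. -/
theorem exists_isSatRel (A : M) : ∃ S, IsSatRel A S := by
  obtain ⟨B, hB⟩ := exists_assignmentSet A
  obtain ⟨F, hF, hrec⟩ := exists_rec (formulaSet M) ImmSub (SatStep A) immSub_wf (by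
    intro c h
    obtain ⟨b, hb⟩ := sep B (fun s => SatStep A c h s)
    exact ⟨b, fun s => (hb s).trans ⟨fun h => h.2, fun h => ⟨(hB s).2 h.1, h⟩⟩⟩)
  obtain ⟨S, hS⟩ := sep (prod (formulaSet M) B)
    (fun o => ∃ c s t, o = opair c s ∧ Val F c t ∧ s ∈ₘ t)
  have hSv : ∀ c s, Val S c s ↔ ∃ t, Val F c t ∧ s ∈ₘ t := by
    intro c s
    rw [val_iff, hS]
    constructor
    · rintro ⟨-, c', s', t, he, hv⟩
      obtain ⟨rfl, rfl⟩ := opair_inj.1 he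
      exact ⟨t, hv⟩
    · rintro ⟨t, hv, hs⟩
      refine ⟨opair_mem_prod.2 ⟨hF.mem_dom hv, (hB s).2 ?_⟩, c, s, t, rfl, hv, hs⟩
      obtain ⟨h, -, hh⟩ := hrec c t hv
      exact ((hh s).1 hs).1
  have hstep : ∀ c s, IsFormula c → ∃ h, (∀ p t, Val h p t ↔ ImmSub p c ∧ Val F p t) ∧
      (Val S c s ↔ SatStep A c h s) := by
    intro c s hc
    obtain ⟨t, ht⟩ := hF.exists_val (mem_formulaSet.2 hc)
    obtain ⟨h, hh, hz⟩ := hrec c t ht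
    refine ⟨h, fun p u => (hh p u).trans ⟨fun h => h.2, fun h => ⟨hF.mem_dom h.2, h⟩⟩, ?_⟩
    rw [hSv, ← hz s]
    refine ⟨?_, fun h => ⟨t, ht, h⟩⟩
    rintro ⟨t', ht', hs⟩
    rwa [hF.unique ht ht']
  have cl := isFormulaClosed_iff.1 (isFormulaClosed_formulaSet (M := M))
  simp only [mem_formulaSet] at cl
  refine ⟨S, fun w hw s hs => ?_⟩
  obtain rfl := isOmega_iff.1 hw
  simp only [IsMemCode, IsEqCode, IsFalsumCode, IsImpCode, IsAllCode, isCode_iff, isEmptySet_iff]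
  refine ⟨?_, ?_, ?_, ?_, ?_⟩
  · rintro c i j hi hj rfl
    obtain ⟨h, -, e⟩ := hstep _ s (cl.1 i j hi hj)
    rw [e]
    simp [SatStep, code_inj, hs]
  · rintro c i j hi hj rfl
    obtain ⟨h, -, e⟩ := hstep _ s (cl.2.1 i j hi hj)
    rw [e]
    simp [SatStep, code_inj, hs]
  -- No clause of `SatStep` has the tag `2`, so falsum is satisfied by nothing.
  · rintro c ⟨e', rfl, rfl⟩
    obtain ⟨h, -, e⟩ := hstep _ s cl.2.2.1
    rw [e]
    simp [SatStep, code_inj]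
  · rintro c p q hp hq rfl
    obtain ⟨h, hh, e⟩ := hstep _ s (cl.2.2.2.1 p q hp hq)
    rw [e, hSv p s, hSv q s]
    simp [SatStep, code_inj, hs, hh, ImmSub]
  · rintro c i p hi hp rfl
    obtain ⟨h, hh, e⟩ := hstep _ s (cl.2.2.2.2 i p hi hp)
    rw [e]
    simp [SatStep, code_inj, hs, hh, ImmSub, hSv]

/-! ### Standard formulas -/

/-- Formulas of the language of set theory with variables indexed by the natural numbers. -/
inductive Fml
  | mem (i j : ℕ)
  | eq (i j : ℕ)
  | falsum
  | imp (φ ψ : Fml)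
  | all (i : ℕ) (φ : Fml)

namespace Fml

/-- The code in `M` of a formula. -/
noncomputable def toCode : Fml → M
  | mem i j => code 0 (num M i) (num M j)
  | eq i j => code 1 (num M i) (num M j)
  | falsum => code 2 (emp M) (emp M)
  | imp φ ψ => code 3 φ.toCode ψ.toCode
  | all i φ => code 4 (num M i) φ.toCode

/-- The formula holds in `(A, ∈)` at the environment `e`. -/
def Holds (A : M) : Fml → (ℕ → M) → Prop
  | mem i j, e => e i ∈ₘ e j
  | eq i j, e => e i = e j
  | falsum, _ => False
  | imp φ ψ, e => φ.Holds A e → ψ.Holds A e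
  | all i φ, e => ∀ a, a ∈ₘ A → φ.Holds A (Function.update e i a)

theorem isFormula_toCode (φ : Fml) : IsFormula (φ.toCode : M) := by
  have cl := isFormulaClosed_iff.1 (isFormulaClosed_formulaSet (M := M))
  simp only [mem_formulaSet] at cl
  induction φ with
  | mem i j => exact cl.1 _ _ (num_mem_om i) (num_mem_om j)
  | eq i j => exact cl.2.1 _ _ (num_mem_om i) (num_mem_om j)
  | falsum => exact cl.2.2.1
  | imp φ ψ h1 h2 => exact cl.2.2.2.1 _ _ h1 h2
  | all i φ h => exact cl.2.2.2.2 _ _ (num_mem_om i) h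

end Fml

theorem exists_update {A s a i : M} (hs : IsAssignment s A) (ha : a ∈ₘ A) (hi : i ∈ₘ om M) :
    ∃ s', IsAssignment s' A ∧ IsUpdate s' s i a := by
  rw [isAssignment_iff] at hs
  obtain ⟨f, hf, hv⟩ := exists_fun (om M) (fun j y => (j = i ∧ y = a) ∨ (j ≠ i ∧ Val s j y)) (by
    intro x hx
    by_cases h : x = i
    · exact ⟨a, .inl ⟨h, rfl⟩⟩
    · obtain ⟨y, hy⟩ := hs.1.exists_val hx
      exact ⟨y, .inr ⟨h, hy⟩⟩) (by
    rintro x - y y' (⟨h, rfl⟩ | ⟨h, hy⟩) (⟨h', rfl⟩ | ⟨h', hy'⟩)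
    exacts [rfl, (h' h).elim, (h h').elim, hs.1.unique hy hy'])
  refine ⟨f, isAssignment_iff.2 ⟨hf, fun x y hxy => ?_⟩, (hv i a).2 ⟨hi, .inl ⟨rfl, rfl⟩⟩,
    fun j hj y => ?_⟩
  · rcases ((hv x y).1 hxy).2 with ⟨-, rfl⟩ | ⟨-, h⟩
    exacts [ha, hs.2 x y h]
  · rw [hv]
    refine ⟨fun h => ?_, fun h => ⟨hs.1.mem_dom h, .inr ⟨hj, h⟩⟩⟩
    rcases h.2 with h | h
    exacts [(hj h.1).elim, h.2]

theorem IsAssignment.unique {s A i x y : M} (hs : IsAssignment s A) (hx : Val s i x)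
    (hy : Val s i y) : x = y :=
  (isAssignment_iff.1 hs).1.unique hx hy

theorem IsUpdate.val {s s' a : M} {i : ℕ} {e : ℕ → M} (h : IsUpdate s' s (num M i) a)
    (he : ∀ n, Val s (num M n) (e n)) (n : ℕ) : Val s' (num M n) (Function.update e i a n) := by
  by_cases hn : n = i
  · subst hn
    simpa using h.1
  · rw [Function.update_of_ne hn, h.2 _ fun h' => hn (num_injective h')]
    exact he n

/-- The `ω` of `M` may be nonstandard, so `M` may have formulas with no external counterpart. The
agreement with external truth is needed, and proved, for the standard formulas only, by external
induction. -/
theorem IsSatRel.val_iff_holds {A S : M} (hS : IsSatRel A S) (φ : Fml) {s : M} {e : ℕ → M}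
    (hs : IsAssignment s A) (he : ∀ n, Val s (num M n) (e n)) :
    Val S φ.toCode s ↔ φ.Holds A e := by
  induction φ generalizing s e with
  | mem i j =>
    rw [Fml.toCode, (hS _ isOmega_om s hs).1 _ (num M i) (num M j) (num_mem_om i) (num_mem_om j)
      (isCode_iff.2 rfl)]
    constructor
    · rintro ⟨x, y, hx, hy, h⟩
      rwa [hs.unique hx (he i), hs.unique hy (he j)] at h
    · exact fun h => ⟨_, _, he i, he j, h⟩
  | eq i j =>
    rw [Fml.toCode, (hS _ isOmega_om s hs).2.1 _ (num M i) (num M j) (num_mem_om i) (num_mem_om j)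
      (isCode_iff.2 rfl)]
    constructor
    · rintro ⟨x, hx, hy⟩
      exact (hs.unique hx (he i)).symm.trans (hs.unique hy (he j))
    · exact fun h => ⟨_, he i, by rw [show e i = e j from h]; exact he j⟩
  | falsum =>
    exact iff_false_intro ((hS _ isOmega_om s hs).2.2.1 _
      ⟨_, isEmptySet_iff.2 rfl, isCode_iff.2 rfl⟩)
  | imp φ ψ h1 h2 =>
    rw [Fml.toCode, (hS _ isOmega_om s hs).2.2.2.1 _ _ _ φ.isFormula_toCode ψ.isFormula_toCode
      (isCode_iff.2 rfl), h1 hs he, h2 hs he]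
    rfl
  | all i φ h =>
    rw [Fml.toCode, (hS _ isOmega_om s hs).2.2.2.2 _ _ _ (num_mem_om i) φ.isFormula_toCode (isCode_iff.2 rfl)]
    constructor
    · intro h' a ha
      obtain ⟨s', hs', hu⟩ := exists_update hs ha (num_mem_om i)
      exact (h hs' (hu.val he)).1 (h' a s' ha hs' hu)
    · exact fun h' a s' ha hs' hu => (h hs' (hu.val he)).2 (h' a ha)

theorem sat_iff_holds (φ : Fml) {A s : M} {e : ℕ → M} (hs : IsAssignment s A)
    (he : ∀ n, Val s (num M n) (e n)) : Sat A φ.toCode s ↔ φ.Holds A e := by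
  constructor
  · rintro ⟨S, hS, hv⟩
    exact (hS.val_iff_holds φ hs he).1 hv
  · intro h
    obtain ⟨S, hS⟩ := exists_isSatRel A
    exact ⟨S, hS, (hS.val_iff_holds φ hs he).2 h⟩

/-- The environment `e` in `X` is (the standard part of) an assignment in `M`. -/
def Assignable (X : M) (e : ℕ → M) : Prop :=
  ∃ s, IsAssignment s X ∧ ∀ n, Val s (num M n) (e n)

/-- An external sequence need not be coded in `M`. Constant sequences altered at finitely many
places are, and they suffice for finitely many parameters. -/
theorem Assignable.const {X d : M} (hd : d ∈ₘ X) : Assignable X fun _ => d := by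
  obtain ⟨f, hf, hv⟩ := exists_fun (om M) (fun _ y => y = d) (fun _ _ => ⟨d, rfl⟩)
    (by rintro x - y y' rfl rfl; rfl)
  exact ⟨f, isAssignment_iff.2 ⟨hf, fun x y h => ((hv x y).1 h).2 ▸ hd⟩,
    fun n => (hv _ _).2 ⟨num_mem_om n, rfl⟩⟩

theorem Assignable.update {X a : M} {e : ℕ → M} (h : Assignable X e) (ha : a ∈ₘ X) (i : ℕ) :
    Assignable X (Function.update e i a) := by
  obtain ⟨s, hs, he⟩ := h
  obtain ⟨s', hs', hu⟩ := exists_update hs ha (num_mem_om i)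
  exact ⟨s', hs', hu.val he⟩

theorem IsElemSub.holds_iff {X A : M} (h : IsElemSub X A) (φ : Fml) {e : ℕ → M}
    (he : Assignable X e) : φ.Holds X e ↔ φ.Holds A e := by
  obtain ⟨s, hs, he⟩ := he
  have hs' : IsAssignment s A := by
    rw [isAssignment_iff] at hs ⊢
    exact ⟨hs.1, fun x y hxy => h.2.1 y (hs.2 x y hxy)⟩
  rw [← sat_iff_holds φ hs he, ← sat_iff_holds φ hs' he]
  exact h.2.2 _ s φ.isFormula_toCode hs

namespace Fml

/-- Negation. -/
def not (φ : Fml) : Fml := imp φ falsum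
/-- Conjunction. -/
def and (φ ψ : Fml) : Fml := not (imp φ (not ψ))
/-- Disjunction. -/
def or (φ ψ : Fml) : Fml := imp (not φ) ψ
/-- Equivalence. -/
def iff (φ ψ : Fml) : Fml := and (imp φ ψ) (imp ψ φ)
/-- Existential quantification. -/
def ex (i : ℕ) (φ : Fml) : Fml := not (all i (not φ))
/-- `v_p = {v_a, v_b}`, with the auxiliary variable `v_z`. -/
def pair (z p a b : ℕ) : Fml := all z (iff (mem z p) (or (eq z a) (eq z b)))

section

variable {A : M} {φ ψ : Fml} {e : ℕ → M} {i : ℕ}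

theorem holds_imp : (imp φ ψ).Holds A e ↔ (φ.Holds A e → ψ.Holds A e) := Iff.rfl
theorem holds_all :
    (all i φ).Holds A e ↔ ∀ a, a ∈ₘ A → φ.Holds A (Function.update e i a) := Iff.rfl
theorem holds_not : (not φ).Holds A e ↔ ¬ φ.Holds A e := Iff.rfl
theorem holds_and : (and φ ψ).Holds A e ↔ φ.Holds A e ∧ ψ.Holds A e := by
  simp only [and, holds_not, holds_imp]; tauto
theorem holds_or : (or φ ψ).Holds A e ↔ φ.Holds A e ∨ ψ.Holds A e := by
  simp only [or, holds_not, holds_imp]; tauto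
theorem holds_iff : (iff φ ψ).Holds A e ↔ (φ.Holds A e ↔ ψ.Holds A e) := by
  simp only [iff, holds_and, holds_imp]; tauto
theorem holds_ex :
    (ex i φ).Holds A e ↔ ∃ a, a ∈ₘ A ∧ φ.Holds A (Function.update e i a) := by
  simp only [ex, holds_not, holds_all]; push Not; rfl

end

theorem holds_pair {A : M} (hA : IsTrans A) {e : ℕ → M} {z p a b : ℕ} (hp : p ≠ z) (ha : a ≠ z)
    (hb : b ≠ z) (hpA : e p ∈ₘ A) (haA : e a ∈ₘ A) (hbA : e b ∈ₘ A) :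
    (pair z p a b).Holds A e ↔ e p = upair (e a) (e b) := by
  rw [pair, holds_all]
  simp only [holds_iff, holds_or, Holds, Function.update_self, Function.update_of_ne hp,
    Function.update_of_ne ha, Function.update_of_ne hb]
  constructor
  · refine fun h => ext fun u => ⟨fun hu => mem_upair.2 ((h u (hA _ hpA _ hu)).1 hu), fun hu => ?_⟩
    rw [mem_upair] at hu
    refine (h u ?_).2 hu
    rcases hu with rfl | rfl <;> assumption
  · intro h u _
    rw [h, mem_upair]

/-- `((v_0, v_1), v_3) ∈ v_2`. -/
def tripleMem : Fml :=
  ex 4 (ex 5 (ex 6 (ex 7 (ex 9 (ex 10 (and (mem 5 2)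
    (and (and (pair 8 6 0 0) (and (pair 8 7 0 1) (pair 8 4 6 7)))
      (and (pair 8 9 4 4) (and (pair 8 10 4 3) (pair 8 5 9 10))))))))))

/-- In `tripleMem`, `v_4` is the inner pair and `v_5` the outer one, `v_6, v_7` and `v_9, v_10` are
their respective Kuratowski components, and `v_8` is the auxiliary variable of `pair`. All of these
sets lie in the transitive closure of `v_2`, so a transitive `A` contains the witnesses. -/
theorem holds_tripleMem {A : M} (hA : IsTrans A) {e : ℕ → M} (he : ∀ n, n < 4 → e n ∈ₘ A) :
    tripleMem.Holds A e ↔ opair (opair (e 0) (e 1)) (e 3) ∈ₘ e 2 := by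
  have h0 := he 0 (by norm_num)
  have h1 := he 1 (by norm_num)
  have h2 := he 2 (by norm_num)
  have h3 := he 3 (by norm_num)
  simp only [tripleMem, holds_ex, holds_and]
  constructor
  · rintro ⟨q, hq, p, hp, s, hs, d, hd, s', hs', d', hd', h, ⟨g1, g2, g3⟩, g4, g5, g6⟩
    rw [holds_pair hA (by decide) (by decide) (by decide)
      (by simpa [Function.update] using ‹_›) (by simpa [Function.update] using ‹_›)
      (by simpa [Function.update] using ‹_›)] at g1 g2 g3 g4 g5 g6
    simp [Function.update, Holds] at h g1 g2 g3 g4 g5 g6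
    subst g1 g2 g3 g4 g5 g6
    exact h
  · intro h
    have hp := hA _ h2 _ h
    have hs' := hA _ hp (upair (opair (e 0) (e 1)) (opair (e 0) (e 1))) (mem_upair.2 (.inl rfl))
    have hd' := hA _ hp (upair (opair (e 0) (e 1)) (e 3)) (mem_upair.2 (.inr rfl))
    have hq := hA _ hs' (opair (e 0) (e 1)) (mem_upair.2 (.inl rfl))
    have hs := hA _ hq (upair (e 0) (e 0)) (mem_upair.2 (.inl rfl))
    have hd := hA _ hq (upair (e 0) (e 1)) (mem_upair.2 (.inr rfl))
    refine ⟨_, hq, _, hp, _, hs, _, hd, _, hs', _, hd', by simpa [Function.update, Holds] using h,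
      ⟨?_, ?_, ?_⟩, ?_, ?_, ?_⟩ <;>
    · rw [holds_pair hA (by decide) (by decide) (by decide)
        (by simpa [Function.update] using ‹_›) (by simpa [Function.update] using ‹_›)
        (by simpa [Function.update] using ‹_›)]
      simp [Function.update, opair]

end Fml

/-- Elementary submodels of transitive sets are closed under the ternary relation coded by one of
their elements. -/
theorem IsElemSub.exists_triple {X A E a b : M} (h : IsElemSub X A) (hA : IsTrans A) (hE : E ∈ₘ X)
    (ha : a ∈ₘ X) (hb : b ∈ₘ X) (hex : ∃ c, opair (opair a b) c ∈ₘ E) :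
    ∃ c, c ∈ₘ X ∧ opair (opair a b) c ∈ₘ E := by
  have hs := h.2.1
  obtain ⟨c, hc⟩ := hex
  have hcA : c ∈ₘ A := by
    refine hA _ (hA _ (hA _ (hs E hE) _ hc) (upair (opair a b) c) ?_) _ ?_
    exacts [mem_upair.2 (.inr rfl), mem_upair.2 (.inr rfl)]
  have he := ((Assignable.const hE).update ha 0).update hb 1
  have hlt : ∀ c, c ∈ₘ A → ∀ n, n < 4 → Function.update (Function.update (Function.update
      (fun _ => E) 0 a) 1 b) 3 c n ∈ₘ A := by
    intro c hc n hn
    interval_cases n <;> simp [Function.update, hs _ ha, hs _ hb, hs _ hE, hc]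
  have h1 : (Fml.ex 3 Fml.tripleMem).Holds A _ := Fml.holds_ex.2 ⟨c, hcA,
    (Fml.holds_tripleMem hA (hlt c hcA)).2 (by simpa [Function.update] using hc)⟩
  obtain ⟨c', hc', h2⟩ := Fml.holds_ex.1 ((h.holds_iff _ he).2 h1)
  have h3 := (h.holds_iff _ (he.update hc' 3)).1 h2
  rw [Fml.holds_tripleMem hA (hlt c' (hs c' hc'))] at h3
  exact ⟨c', hc', by simpa [Function.update] using h3⟩

/-- A transitive set satisfies extensionality, and elementarity passes it to `X`: distinct elements
of `X` are separated by an element of `X`. -/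
theorem IsElemSub.extensional {X A x y : M} (h : IsElemSub X A) (hA : IsTrans A) (hx : x ∈ₘ X)
    (hy : y ∈ₘ X) (hxy : ∀ c, c ∈ₘ X → (c ∈ₘ x ↔ c ∈ₘ y)) : x = y := by
  have hs := h.2.1
  have he := (Assignable.const hx).update hy 1
  have h1 : (Fml.imp (Fml.all 2 (Fml.iff (Fml.mem 2 0) (Fml.mem 2 1))) (Fml.eq 0 1)).Holds A
      (Function.update (fun _ => x) 1 y) := by
    simp only [Fml.holds_imp, Fml.holds_all, Fml.holds_iff]
    simp only [Fml.Holds, Function.update]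
    simp only [dite_eq_ite, eq_rec_constant]
    norm_num
    intro h
    refine ext fun z => ⟨fun hz => ?_, fun hz => ?_⟩
    · exact (h z (hA _ (hs x hx) z hz)).1 hz
    · exact (h z (hA _ (hs y hy) z hz)).2 hz
  have h2 := (h.holds_iff _ he).2 h1
  simp only [Fml.holds_imp, Fml.holds_all, Fml.holds_iff] at h2
  simp only [Fml.Holds, Function.update] at h2
  simp only [dite_eq_ite, eq_rec_constant] at h2
  norm_num at h2
  exact h2 hxy

/-! ### Hulls of small sets -/

/-- If `κ ⊆ X`, the collapse fixes every ordinal below `κ`, so `κ ⊆ T`. But `T ⊆ V_δ` for some `δ <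
κ`, and `δ ∉ V_δ`. -/
theorem not_subs_of_collapse {κ X T : M} (hκ : IsOrd κ) (hT : IsCollapse T X) (hTκ : T ∈ₘ V κ) :
    ¬ Subs κ X := by
  intro hX
  obtain ⟨π, hπ, hrec, hran⟩ := hT
  have hid : ∀ β, β ∈ₘ κ → Val π β β := fun β hβ =>
    ord_induction (fun β => β ∈ₘ κ → Val π β β) (by
      intro β hβo ih hβ
      obtain ⟨t, ht⟩ := hπ.exists_val (hX β hβ)
      suffices t = β from this ▸ ht
      refine ext fun z => ?_
      rw [hrec β t ht]
      constructor
      · rintro ⟨y, -, hy, hv⟩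
        rwa [hπ.unique hv (ih y hy (hκ.trans hβ hy))]
      · exact fun hz => ⟨z, hX z (hκ.trans hβ hz), hz, ih z hz (hκ.trans hβ hz)⟩)
      (hκ.mem hβ) hβ
  obtain ⟨δ, hδ, hTδ⟩ := (mem_V hκ).1 hTκ
  exact not_mem_V (hκ.mem hδ) (hTδ δ ((hran δ).2 ⟨δ, hid δ hδ⟩))

/-- The collapse is injective because `X` is extensional, as an `∈`-minimal counterexample shows;
its inverse maps `T` onto `X`. -/
theorem IsElemSub.onto_of_collapse {X A T : M} (h : IsElemSub X A) (hA : IsTrans A)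
    (hT : IsCollapse T X) : Onto T X := by
  obtain ⟨π, hπ, hrec, hran⟩ := hT
  have inj : ∀ x y t, Val π x t → Val π y t → x = y := by
    by_contra hc
    push Not at hc
    obtain ⟨x, y, t, hx, hy, hne⟩ := hc
    obtain ⟨Z, hZ⟩ := sep X (fun x => ∃ y t, Val π x t ∧ Val π y t ∧ x ≠ y)
    obtain ⟨x, hxZ, hm⟩ := exists_minimal (x := Z) ⟨x, (hZ x).2 ⟨hπ.mem_dom hx, y, t, hx, hy, hne⟩⟩
    obtain ⟨hxX, y, t, hx, hy, hne⟩ := (hZ x).1 hxZ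
    have key : ∀ c d s, c ∈ₘ x → Val π c s → Val π d s → c = d := by
      intro c d s hc h1 h2
      by_contra hcd
      exact hm c ((hZ c).2 ⟨hπ.mem_dom h1, d, s, h1, h2, hcd⟩) hc
    refine hne (h.extensional hA hxX (hπ.mem_dom hy) fun c hc => ⟨fun hcx => ?_, fun hcy => ?_⟩)
    · obtain ⟨s, hs⟩ := hπ.exists_val hc
      obtain ⟨d, -, hdy, hd⟩ := (hrec y t hy s).1 ((hrec x t hx s).2 ⟨c, hc, hcx, hs⟩)
      rwa [key c d s hcx hs hd]
    · obtain ⟨s, hs⟩ := hπ.exists_val hc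
      obtain ⟨d, -, hdx, hd⟩ := (hrec x t hx s).1 ((hrec y t hy s).2 ⟨c, hc, hcy, hs⟩)
      rwa [← key d c s hdx hd hs]
  refine Onto.of_rel (fun t x => Val π x t) (fun t x y _ hx hy => inj x y t hx hy) fun x hx => ?_
  obtain ⟨t, ht⟩ := hπ.exists_val hx
  exact ⟨t, (hran t).2 ⟨x, ht⟩, ht⟩

theorem IsWeaklyLS.isOrd {κ : M} (h : IsWeaklyLS κ) : IsOrd κ := h.1.1.1

theorem IsWeaklyLS.om_mem {κ : M} (h : IsWeaklyLS κ) : om M ∈ₘ κ := by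
  obtain ⟨w, hw, hwκ⟩ := h.1.2
  exact isOmega_iff.1 hw ▸ hwκ

/-- Were `κ = β + 1`, an elementary submodel including `V_β` and containing `β` would include `κ`.
-/
theorem IsWeaklyLS.isLimit {κ : M} (h : IsWeaklyLS κ) : IsLimit κ := by
  refine ⟨h.isOrd, fun β hβ => ?_⟩
  have hβo := h.isOrd.mem hβ
  rcases succ_le_of_mem h.isOrd hβ with e | e
  · obtain ⟨X, hX, hVX, hβX, T, hT, hTκ⟩ := h.2 β κ (V β) (V κ) (V κ) β hβ (.inl rfl) (isV_V hβo)
      (isV_V h.isOrd) (isV_V h.isOrd) (mem_V_of_mem h.isOrd hβ)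
    refine (not_subs_of_collapse h.isOrd hT hTκ fun z hz => ?_).elim
    rw [← e, mem_succ] at hz
    rcases hz with hz | rfl
    exacts [hVX z (subs_V hβo z hz), hβX]
  · exact e

/-- The choiceless substitute for a Skolem hull. `R`, cut down to `A × A × B`, is a set `E`; an
elementary submodel containing `E` has a witness whenever there is one, although none is singled
out. Two arguments suffice for every later use. -/
theorem IsWeaklyLS.exists_hull {κ : M} (h : IsWeaklyLS κ) {x : M} (hx : x ∈ₘ V κ) (A B : M)
    (R : M → M → M → Prop) [hR : FO fun v : ℕ → M => R (v 0) (v 1) (v 2)] :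
    ∃ X T, T ∈ₘ V κ ∧ Onto T X ∧ Subs x X ∧ ¬ Subs κ X ∧ ∀ a b, a ∈ₘ X → b ∈ₘ X →
      a ∈ₘ A → b ∈ₘ A → (∃ c, c ∈ₘ B ∧ R a b c) → ∃ c, c ∈ₘ X ∧ c ∈ₘ B ∧ R a b c := by
  have hR' := fun (t u w : (ℕ → M) → M) [DF t] [DF u] [DF w] =>
    FO.subst₃ hR (t := t) (u := u) (w := w)
  obtain ⟨E, hE⟩ := sep (prod (prod A A) B)
    (fun o => ∃ a b c, o = opair (opair a b) c ∧ R a b c)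
  have hE' : ∀ a b c, opair (opair a b) c ∈ₘ E ↔ a ∈ₘ A ∧ b ∈ₘ A ∧ c ∈ₘ B ∧ R a b c := by
    intro a b c
    rw [hE, opair_mem_prod, opair_mem_prod]
    constructor
    · rintro ⟨⟨⟨ha, hb⟩, hc⟩, a', b', c', he, hr⟩
      obtain ⟨h1, rfl⟩ := opair_inj.1 he
      obtain ⟨rfl, rfl⟩ := opair_inj.1 h1
      exact ⟨ha, hb, hc, hr⟩
    · rintro ⟨ha, hb, hc, hr⟩
      exact ⟨⟨⟨ha, hb⟩, hc⟩, a, b, c, rfl, hr⟩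
  obtain ⟨γ, hγ, hxγ⟩ := (mem_V h.isOrd).1 hx
  obtain ⟨α, hα, hEα⟩ := exists_mem_V E
  have ho := isOrd_union h.isOrd hα
  -- `union κ α` is the larger of the two ordinals: at least `κ`, and high enough for `E`.
  obtain ⟨X, hX, hVX, hEX, T, hT, hTκ⟩ := h.2 γ (union κ α) (V γ) (V (union κ α)) (V κ) E hγ
    (le_of_subs h.isOrd ho fun z hz => mem_union.2 (.inl hz)) (isV_V (h.isOrd.mem hγ)) (isV_V ho)
    (isV_V h.isOrd) (V_mono hα ho (fun z hz => mem_union.2 (.inr hz)) E hEα)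
  refine ⟨X, T, hTκ, hX.onto_of_collapse (isTrans_V ho) hT, hxγ.trans hVX,
    not_subs_of_collapse h.isOrd hT hTκ, fun a b ha hb haA hbA hc => ?_⟩
  obtain ⟨c, hc, hr⟩ := hc
  obtain ⟨c', hc', hE''⟩ := hX.exists_triple (isTrans_V ho) hEX ha hb
    ⟨c, (hE' a b c).2 ⟨haA, hbA, hc, hr⟩⟩
  rw [hE'] at hE''
  exact ⟨c', hc', hE''.2.2⟩

/-- A hull of `x` closed under the map would contain all its values, hence include `κ`. -/
theorem IsWeaklyLS.not_onto {κ x : M} (h : IsWeaklyLS κ) (hx : x ∈ₘ V κ) : ¬ Onto x κ := by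
  rintro ⟨f, hf, hs⟩
  obtain ⟨X, T, -, -, hxX, hn, hcl⟩ := h.exists_hull hx x κ (fun a _ c => Val f a c)
  refine hn fun y hy => ?_
  obtain ⟨a, ha, hv⟩ := hs y hy
  obtain ⟨c, hcX, -, hc⟩ := hcl a a (hxX a ha) (hxX a ha) ha ha ⟨y, hy, hv⟩
  rwa [hf a y c hv hc]

/-! ### Surjections and cardinals -/

theorem IsBij.onto {f a b : M} (h : IsBij f a b) : Onto a b := h.1.onto

/-- Passes from bijections, used in the definition of cardinals, to partial surjections. The least
preimages form a subset of `δ`, whose collapse is an ordinal `θ ≤ δ` in bijection with `κ`. -/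
theorem IsCard.not_onto {κ δ : M} (hκ : IsCard κ) (hδ : δ ∈ₘ κ) : ¬ Onto δ κ := by
  rintro ⟨f, hf, hs⟩
  have hδo := hκ.1.mem hδ
  obtain ⟨W, hW⟩ := sep δ (fun a => ∃ y, y ∈ₘ κ ∧ Val f a y ∧ ∀ b, b ∈ₘ a → ¬ Val f b y)
  obtain ⟨G, hG1, hG2⟩ := exists_collapse W Mem (mem_wf W)
  have hG : Collapses G W Mem := ⟨hG1, fun h => hG2 _ _ h _⟩
  have hWo : ∀ a, a ∈ₘ W → IsOrd a := fun a ha => hδo.mem ((hW a).1 ha).1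
  have hGo : ∀ {a t}, Val G a t → IsOrd t := fun h =>
    hG.isOrd (fun x y z _ _ hz hxy hyz => (hWo z hz).trans hyz hxy) h
  have hle : ∀ a t, Val G a t → Le t a := fun a t ht =>
    ord_induction (fun a => ∀ t, Val G a t → Le t a) (by
      intro a ha ih t ht
      refine le_of_subs (hGo ht) ha fun z hz => ?_
      obtain ⟨y, hya, hy⟩ := hG.of_mem ht hz
      exact (ih y hya z hy).trans_mem ha hya) (hWo a (hG1.mem_dom ht)) t ht
  obtain ⟨θ, hθ⟩ := exists_range G
  have hθo : IsOrd θ := isOrd_of_trans (fun t ht z hz => by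
    obtain ⟨a, ha⟩ := (hθ t).1 ht
    obtain ⟨y, -, hy⟩ := hG.of_mem ha hz
    exact (hθ z).2 ⟨y, hy⟩) fun t ht => by
    obtain ⟨a, ha⟩ := (hθ t).1 ht
    exact hGo ha
  have hθκ : θ ∈ₘ κ := by
    refine Le.trans_mem hκ.1 (le_of_subs hθo hδo fun t ht => ?_) hδ
    obtain ⟨a, ha⟩ := (hθ t).1 ht
    exact (hle a t ha).trans_mem hδo ((hW a).1 (hG1.mem_dom ha)).1
  have hinj : ∀ a b t, Val G a t → Val G b t → a = b := fun a b t ha hb =>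
    hG.eq_of_val ((hWo a (hG1.mem_dom ha)).trichotomy (hWo b (hG1.mem_dom hb))) ha hb
  obtain ⟨g, hg, hgv⟩ := exists_fun θ (fun t y => ∃ a, Val G a t ∧ Val f a y)
    (fun t ht => by
      obtain ⟨a, ha⟩ := (hθ t).1 ht
      obtain ⟨-, y, -, hy, -⟩ := (hW a).1 (hG1.mem_dom ha)
      exact ⟨y, a, ha, hy⟩)
    (by
      rintro t - y y' ⟨a, ha, hy⟩ ⟨b, hb, hy'⟩
      obtain rfl := hinj a b t ha hb
      exact hf a y y' hy hy')
  refine hκ.2 θ hθκ ⟨g, ⟨⟨hg, fun t y hty => ?_⟩, fun y hy => ?_⟩, fun t t' y ht ht' => ?_⟩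
  · obtain ⟨-, a, ha, hy⟩ := (hgv t y).1 hty
    obtain ⟨-, y', hy'κ, hy', -⟩ := (hW a).1 (hG1.mem_dom ha)
    rwa [hf a y y' hy hy']
  · obtain ⟨a₀, ha₀, hv₀⟩ := hs y hy
    obtain ⟨a, -, hv, hle', hm⟩ := ord_min (fun a => Val f a y) (hδo.mem ha₀) hv₀
    have haW : a ∈ₘ W := (hW a).2 ⟨hle'.trans_mem hδo ha₀, y, hy, hv, hm⟩
    obtain ⟨t, ht⟩ := hG1.exists_val haW
    exact ⟨t, (hgv t y).2 ⟨(hθ t).2 ⟨a, ht⟩, a, ht, hv⟩⟩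
  · obtain ⟨-, a, ha, hy⟩ := (hgv t y).1 ht
    obtain ⟨-, b, hb, hy'⟩ := (hgv t' y).1 ht'
    obtain ⟨-, ya, -, hya, hma⟩ := (hW a).1 (hG1.mem_dom ha)
    obtain ⟨-, yb, -, hyb, hmb⟩ := (hW b).1 (hG1.mem_dom hb)
    obtain rfl := hf a y ya hy hya
    obtain rfl := hf b y yb hy' hyb
    rcases (hWo a (hG1.mem_dom ha)).trichotomy (hWo b (hG1.mem_dom hb)) with h | rfl | h
    exacts [(hmb a h hy).elim, hG1.unique ha hb, (hma b h hy').elim]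

/-! ### Squares of well-ordered cardinals -/

/-- Gödel's well-ordering of pairs of ordinals. -/
def PairLt (x y : M) : Prop :=
  ∃ a b c d, x = opair a b ∧ y = opair c d ∧ (union a b ∈ₘ union c d ∨
    (union a b = union c d ∧ (a ∈ₘ c ∨ (a = c ∧ b ∈ₘ d))))

instance {t u : (ℕ → M) → M} [DF t] [DF u] : FO fun v => PairLt (t v) (u v) := by
  unfold PairLt; infer_instance

theorem pairLt_opair {a b c d : M} : PairLt (opair a b) (opair c d) ↔
    union a b ∈ₘ union c d ∨ (union a b = union c d ∧ (a ∈ₘ c ∨ (a = c ∧ b ∈ₘ d))) := by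
  constructor
  · rintro ⟨a', b', c', d', h1, h2, h⟩
    obtain ⟨rfl, rfl⟩ := opair_inj.1 h1
    obtain ⟨rfl, rfl⟩ := opair_inj.1 h2
    exact h
  · exact fun h => ⟨a, b, c, d, rfl, rfl, h⟩

/-- Minimise the maximum of the coordinates, then the first coordinate, then the second; on ordinals
`union` is the maximum. -/
theorem pairLt_wf {β : M} (hβ : IsOrd β) (Z : M) (hZ : Subs Z (prod β β)) (h : ∃ w, w ∈ₘ Z) :
    ∃ w, w ∈ₘ Z ∧ ∀ w', w' ∈ₘ Z → ¬ PairLt w' w := by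
  have hmem : ∀ {a b}, opair a b ∈ₘ Z → a ∈ₘ β ∧ b ∈ₘ β := fun h => opair_mem_prod.1 (hZ _ h)
  obtain ⟨w, hw⟩ := h
  obtain ⟨a₀, b₀, ha₀, hb₀, rfl⟩ := mem_prod.1 (hZ w hw)
  obtain ⟨m, -, ⟨a₁, b₁, h₁, rfl⟩, -, hm⟩ := ord_min
    (fun m => ∃ a b, opair a b ∈ₘ Z ∧ union a b = m) (isOrd_union (hβ.mem ha₀) (hβ.mem hb₀))
    ⟨a₀, b₀, hw, rfl⟩
  obtain ⟨a, -, ⟨b₂, h₂, e₂⟩, -, ha⟩ := ord_min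
    (fun a => ∃ b, opair a b ∈ₘ Z ∧ union a b = union a₁ b₁) (hβ.mem (hmem h₁).1) ⟨b₁, h₁, rfl⟩
  obtain ⟨b, -, ⟨h₃, e₃⟩, -, hb⟩ := ord_min
    (fun b => opair a b ∈ₘ Z ∧ union a b = union a₁ b₁) (hβ.mem (hmem h₂).2) ⟨h₂, e₂⟩
  refine ⟨_, h₃, fun w' hw' hlt => ?_⟩
  obtain ⟨c, d, hc, hd, rfl⟩ := mem_prod.1 (hZ w' hw')
  rcases pairLt_opair.1 hlt with h | ⟨e, h | ⟨rfl, h⟩⟩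
  · exact hm _ (e₃ ▸ h) ⟨c, d, hw', rfl⟩
  · exact ha c h ⟨d, hw', e.trans e₃⟩
  · exact hb d h ⟨hw', e.trans e₃⟩

theorem pairLt_trans {β : M} (hβ : IsOrd β) {x y z : M} (hx : x ∈ₘ prod β β) (hy : y ∈ₘ prod β β)
    (hz : z ∈ₘ prod β β) (hxy : PairLt x y) (hyz : PairLt y z) : PairLt x z := by
  obtain ⟨a, b, ha, hb, rfl⟩ := mem_prod.1 hx
  obtain ⟨c, d, hc, hd, rfl⟩ := mem_prod.1 hy
  obtain ⟨e, f, he, hf, rfl⟩ := mem_prod.1 hz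
  rw [pairLt_opair] at *
  have h1 := (isOrd_union (hβ.mem he) (hβ.mem hf)).trans (β := union c d) (γ := union a b)
  have h2 := (hβ.mem he).trans (β := c) (γ := a)
  have h3 := (hβ.mem hf).trans (β := d) (γ := b)
  rcases hxy with p | ⟨p, q | ⟨rfl, q⟩⟩ <;> rcases hyz with r | ⟨r, s | ⟨rfl, s⟩⟩
  · exact .inl (h1 r p)
  · exact .inl (r ▸ p)
  · exact .inl (r ▸ p)
  · exact .inl (p ▸ r)
  · exact .inr ⟨p.trans r, .inl (h2 s q)⟩
  · exact .inr ⟨p.trans r, .inl q⟩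
  · exact .inl (p ▸ r)
  · exact .inr ⟨p.trans r, .inl s⟩
  · exact .inr ⟨p.trans r, .inr ⟨rfl, h3 s q⟩⟩

theorem pairLt_tri {β : M} (hβ : IsOrd β) {x y : M} (hx : x ∈ₘ prod β β) (hy : y ∈ₘ prod β β) :
    PairLt x y ∨ x = y ∨ PairLt y x := by
  obtain ⟨a, b, ha, hb, rfl⟩ := mem_prod.1 hx
  obtain ⟨c, d, hc, hd, rfl⟩ := mem_prod.1 hy
  simp only [pairLt_opair, opair_inj]
  have h1 := (isOrd_union (hβ.mem ha) (hβ.mem hb)).trichotomy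
    (isOrd_union (hβ.mem hc) (hβ.mem hd))
  have h2 := (hβ.mem ha).trichotomy (hβ.mem hc)
  have h3 := (hβ.mem hb).trichotomy (hβ.mem hd)
  rcases h1 with h1 | h1 | h1
  · exact .inl (.inl h1)
  · rcases h2 with h2 | h2 | h2
    · exact .inl (.inr ⟨h1, .inl h2⟩)
    · rcases h3 with h3 | h3 | h3
      · exact .inl (.inr ⟨h1, .inr ⟨h2, h3⟩⟩)
      · exact .inr (.inl ⟨h2, h3⟩)
      · exact .inr (.inr (.inr ⟨h1.symm, .inr ⟨h2.symm, h3⟩⟩))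
    · exact .inr (.inr (.inr ⟨h1.symm, .inl h2⟩))
  · exact .inr (.inr (.inl h1))

/-- Send `(0, y)` to `y` and `(1, 0)` to the extra point `b`. -/
theorem onto_prod_succ {b : M} (hb : IsOrd b) (h : om M ∈ₘ succ b) :
    Onto (prod b b) (succ b) := by
  have hω : Subs (om M) b := (mem_succ_iff_le.1 h).subs hb
  have h0 : emp M ∈ₘ b := hω _ emp_mem_om
  have h1 : succ (emp M) ∈ₘ b := hω _ (succ_mem_om emp_mem_om)
  have hne : emp M ≠ succ (emp M) := fun e =>
    not_mem_emp ((congrArg (emp M ∈ₘ ·) e).mpr (mem_succ_self _))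
  refine Onto.of_rel (fun w y => w = opair (emp M) y ∨ (w = opair (succ (emp M)) (emp M) ∧ y = b))
    ?_ fun y hy => ?_
  · rintro w y y' - (rfl | ⟨rfl, rfl⟩) (e | ⟨e, rfl⟩)
    · exact (opair_inj.1 e).2
    · exact (hne (opair_inj.1 e).1).elim
    · exact (hne (opair_inj.1 e).1.symm).elim
    · rfl
  · rcases mem_succ.1 hy with hy | rfl
    · exact ⟨_, opair_mem_prod.2 ⟨h0, hy⟩, .inl rfl⟩
    · exact ⟨_, opair_mem_prod.2 ⟨h1, h0⟩, .inr ⟨rfl, rfl⟩⟩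

theorem isLimit_of_not_onto {β : M} (hβ : IsOrd β) (hω : om M ∈ₘ β)
    (h : ∀ b, b ∈ₘ β → ¬ Onto (prod b b) β) : IsLimit β := by
  refine ⟨hβ, fun b hb => ?_⟩
  rcases succ_le_of_mem hβ hb with e | e
  · exact (h b hb (e ▸ onto_prod_succ (hβ.mem hb) (e ▸ hω))).elim
  · exact e

/-- Hessenberg's argument by induction on `β`, for all `l` at once because the hypothesis is also
used with `β` in the role of `l`. If `β < κ`, then `β × β ∈ V_κ`. If `β` is not a cardinal, a
smaller ordinal replaces it. Otherwise Gödel's order on `β × β` has type at most `β`, so `β` would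
map onto `β × β` and hence onto `l`. -/
theorem IsWeaklyLS.not_onto_prod_self {κ β l : M} (h : IsWeaklyLS κ) (hl : IsCard l)
    (hκl : Le κ l) (hβ : β ∈ₘ l) : ¬ Onto (prod β β) l := by
  refine ord_induction (fun β => ∀ l, IsCard l → Le κ l → β ∈ₘ l → ¬ Onto (prod β β) l) ?_
    (hl.1.mem hβ) l hl hκl hβ
  clear hl hκl hβ β l
  intro β hβo ih l hl hκl hβ honto
  rcases h.isOrd.le_or_mem hβo with hκβ | hβκ
  swap
  · exact h.not_onto (h.isLimit.prod_ord hβκ) (honto.mono (Subs.refl _) (hκl.subs hl.1))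
  by_cases hc : IsCard β
  swap
  · have : ∃ δ, δ ∈ₘ β ∧ ∃ f, IsBij f δ β := by
      by_contra hc'
      push Not at hc'
      exact hc ⟨hβo, fun δ hδ ⟨f, hf⟩ => hc' δ hδ f hf⟩
    obtain ⟨δ, hδ, f, hf⟩ := this
    exact ih δ hδ l hl hκl (hl.1.trans hβ hδ) ((hf.onto.prod hf.onto).trans honto)
  have hlim : IsLimit β := isLimit_of_not_onto hβo (hκβ.subs hβo _ h.om_mem)
    fun b hb => ih b hb β hc hκβ hb
  obtain ⟨G, hG1, hG2⟩ := exists_collapse (prod β β) PairLt (pairLt_wf hβo)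
  have hG : Collapses G (prod β β) PairLt := ⟨hG1, fun h => hG2 _ _ h _⟩
  have hval : ∀ w t, Val G w t → t ∈ₘ β := by
    intro w t ht
    have hto : IsOrd t := hG.isOrd (fun x y z hx hy hz => pairLt_trans hβo hx hy hz) ht
    rcases hβo.le_or_mem hto with hle | hmem
    swap
    · exact hmem
    exfalso
    obtain ⟨a, b, ha, hb, rfl⟩ := mem_prod.1 (hG1.mem_dom ht)
    have hm : union a b ∈ₘ β := by
      rcases union_eq_of_ord (hβo.mem ha) (hβo.mem hb) with e | e <;> rw [e] <;> assumption
    have hmo := hβo.mem hm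
    -- The predecessors of `(a, b)` lie in the square of `max a b + 1`, which is below `β`. If they
    -- had order type at least `β`, this square would map onto `β`.
    refine ih _ (hlim.2 _ hm) β hc hκβ (hlim.2 _ hm) (Onto.of_rel (Val G)
      (fun _ _ _ _ => hG1.unique) fun y hy => ?_)
    obtain ⟨w', hlt, hw'⟩ := hG.of_mem ht (hle.subs hto y hy)
    obtain ⟨c, d, hc', hd, rfl⟩ := mem_prod.1 (hG1.mem_dom hw')
    have hsub : Subs (union c d) (union a b) := by
      rcases pairLt_opair.1 hlt with h | h
      exacts [hmo.1 _ h, h.1 ▸ Subs.refl _]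
    refine ⟨_, opair_mem_prod.2 ⟨mem_succ_iff_le.2 (le_of_subs (hβo.mem hc') hmo fun z hz => ?_),
      mem_succ_iff_le.2 (le_of_subs (hβo.mem hd) hmo fun z hz => ?_)⟩, hw'⟩
    exacts [hsub z (mem_union.2 (.inl hz)), hsub z (mem_union.2 (.inr hz))]
  refine hl.not_onto hβ (Onto.trans (Onto.of_rel (B := prod β β) (fun t w => Val G w t)
    (fun t w w' _ hw hw' => ?_) fun w hw => ?_) honto)
  · exact hG.eq_of_val (pairLt_tri hβo (hG1.mem_dom hw) (hG1.mem_dom hw')) hw hw'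
  · obtain ⟨t, ht⟩ := hG1.exists_val hw
    exact ⟨t, hval w t ht, ht⟩

theorem IsWeaklyLS.isLimit_card {κ l : M} (h : IsWeaklyLS κ) (hl : IsCard l) (hκl : Le κ l) :
    IsLimit l :=
  isLimit_of_not_onto hl.1 (hκl.subs hl.1 _ h.om_mem) fun _ => h.not_onto_prod_self hl hκl

/-! ### Successor cardinals -/

/-- An ordinal strictly between `l` and `μ` is not a cardinal, so it is a bijective image of a
smaller ordinal, to which induction applies. -/
theorem IsSuccCard.onto {l μ ξ : M} (h : IsSuccCard μ l) (hξ : ξ ∈ₘ μ) : Onto l ξ := by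
  have hμ := h.1.1
  have hl := hμ.mem h.2.1
  refine ord_induction (fun ξ => ξ ∈ₘ μ → Onto l ξ) ?_ (hμ.mem hξ) hξ
  intro ξ hξo ih hξ
  rcases hξo.le_or_mem hl with hle | hlξ
  · exact Onto.of_subs (hle.subs hl)
  · have : ∃ δ, δ ∈ₘ ξ ∧ ∃ f, IsBij f δ ξ := by
      by_contra hc'
      push Not at hc'
      exact not_mem_of_le hξo (h.2.2 ξ ⟨hξo, fun δ hδ ⟨f, hf⟩ => hc' δ hδ f hf⟩ hlξ) hξ
    obtain ⟨δ, hδ, f, hf⟩ := this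
    exact (ih δ hδ (hμ.trans hξ hδ)).trans hf.onto

/-- The slice of values at `(t, η)`, for `t ∈ T`, is an image of `T` and so has order type below `κ
≤ l`. Naming a value by `η` and its position in the slice would map `l × l` onto `μ`. -/
theorem IsWeaklyLS.not_onto_prod {κ l μ T : M} (h : IsWeaklyLS κ) (hκl : Le κ l)
    (hμ : IsSuccCard μ l) (hT : T ∈ₘ V κ) : ¬ Onto (prod T l) μ := by
  rintro ⟨f, hf, hs⟩
  have hμo := hμ.1.1
  have hlo := hμo.mem hμ.2.1
  obtain ⟨W, hW⟩ := sep (prod l μ)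
    (fun w => ∃ η ξ t, w = opair η ξ ∧ t ∈ₘ T ∧ Val f (opair t η) ξ)
  have hWm : ∀ η ξ, opair η ξ ∈ₘ W ↔ η ∈ₘ l ∧ ξ ∈ₘ μ ∧ ∃ t, t ∈ₘ T ∧ Val f (opair t η) ξ := by
    intro η ξ
    rw [hW, opair_mem_prod, and_assoc]
    refine and_congr_right fun _ => and_congr_right fun _ => ⟨?_, fun ⟨t, ht⟩ => ⟨η, ξ, t, rfl, ht⟩⟩
    rintro ⟨η', ξ', t, e, ht⟩
    obtain ⟨rfl, rfl⟩ := opair_inj.1 e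
    exact ⟨t, ht⟩
  -- Only points of the same slice are compared, so a single collapse enumerates all slices
  -- simultaneously.
  let R : M → M → Prop := fun x y => ∃ η ξ ξ', x = opair η ξ ∧ y = opair η ξ' ∧ ξ ∈ₘ ξ'
  have hR : ∀ {η ξ y}, R y (opair η ξ) ↔ ∃ ξ', y = opair η ξ' ∧ ξ' ∈ₘ ξ := by
    intro η ξ y
    constructor
    · rintro ⟨η', ξ', ξ'', rfl, e, hlt⟩
      obtain ⟨rfl, rfl⟩ := opair_inj.1 e
      exact ⟨ξ', rfl, hlt⟩
    · rintro ⟨ξ', rfl, hlt⟩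
      exact ⟨η, ξ', ξ, rfl, rfl, hlt⟩
  have hRd : FO fun v : ℕ → M => R (v 0) (v 1) := by
    show FO fun v : ℕ → M => ∃ η ξ ξ', v 0 = opair η ξ ∧ v 1 = opair η ξ' ∧ ξ ∈ₘ ξ'
    infer_instance
  have hWo : ∀ {w}, w ∈ₘ W → ∃ η ξ, w = opair η ξ ∧ IsOrd ξ := by
    intro w hw
    obtain ⟨η, ξ, -, hξ, rfl⟩ := mem_prod.1 ((hW w).1 hw).1
    exact ⟨η, ξ, rfl, hμo.mem hξ⟩
  obtain ⟨G, hG1, hG2⟩ := exists_collapse W R (by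
    rintro Z hZ ⟨w, hw⟩
    obtain ⟨η, ξ, rfl, hξ⟩ := hWo (hZ w hw)
    obtain ⟨ξ, -, hξZ, -, hm⟩ := ord_min (fun ξ => opair η ξ ∈ₘ Z) hξ hw
    refine ⟨_, hξZ, fun w' hw' hlt => ?_⟩
    obtain ⟨ξ', rfl, hlt'⟩ := hR.1 hlt
    exact hm ξ' hlt' hw')
  have hG : Collapses G W R := ⟨hG1, fun h => hG2 _ _ h _⟩
  have hval : ∀ {η ξ t}, Val G (opair η ξ) t → t ∈ₘ κ := by
    intro η ξ t ht
    have hto : IsOrd t := hG.isOrd (by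
      intro x y z _ _ hz hxy hyz
      obtain ⟨η, ξ, rfl, hξ⟩ := hWo hz
      obtain ⟨ξ', rfl, h1⟩ := hR.1 hyz
      obtain ⟨ξ'', rfl, h2⟩ := hR.1 hxy
      exact hR.2 ⟨ξ'', rfl, hξ.trans h1 h2⟩) ht
    rcases h.isOrd.le_or_mem hto with hle | hmem
    swap
    · exact hmem
    -- A position at or above `κ` would give a map from `T` onto `κ`: send `t` to the position of
    -- its value, if that position is defined.
    refine (h.not_onto hT (Onto.of_rel
      (fun t z => ∃ ξ', Val f (opair t η) ξ' ∧ Val G (opair η ξ') z) ?_ fun z hz => ?_)).elim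
    · rintro t z z' - ⟨ξ₁, h1, h2⟩ ⟨ξ₂, h3, h4⟩
      obtain rfl := hf _ _ _ h1 h3
      exact hG1.unique h2 h4
    · obtain ⟨y, hy, hv⟩ := hG.of_mem ht (hle.subs hto z hz)
      obtain ⟨ξ', rfl, -⟩ := hR.1 hy
      obtain ⟨-, -, t, htT, hvt⟩ := (hWm _ _).1 (hG1.mem_dom hv)
      exact ⟨t, htT, ξ', hvt, hv⟩
  refine h.not_onto_prod_self hμ.1 (.inr (hκl.trans_mem hμo hμ.2.1)) hμ.2.1 (Onto.of_rel
    (fun p ξ => ∃ η ζ, p = opair η ζ ∧ Val G (opair η ξ) ζ) ?_ fun ξ hξ => ?_)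
  · rintro p ξ ξ' - ⟨η, ζ, rfl, h1⟩ ⟨η', ζ', e, h2⟩
    obtain ⟨rfl, rfl⟩ := opair_inj.1 e
    have ho : ∀ {ξ}, Val G (opair η ξ) ζ → IsOrd ξ := fun h => by
      exact hμo.mem ((hWm _ _).1 (hG1.mem_dom h)).2.1
    have := hG.eq_of_val (x := opair η ξ) (y := opair η ξ') (by
      rcases (ho h1).trichotomy (ho h2) with h | rfl | h
      exacts [.inl (hR.2 ⟨_, rfl, h⟩), .inr (.inl rfl), .inr (.inr (hR.2 ⟨_, rfl, h⟩))]) h1 h2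
    exact (opair_inj.1 this).2
  · obtain ⟨p, hp, hv⟩ := hs ξ hξ
    obtain ⟨t, η, ht, hη, rfl⟩ := mem_prod.1 hp
    obtain ⟨ζ, hζ⟩ := hG1.exists_val ((hWm η ξ).2 ⟨hη, hξ, t, ht, hv⟩)
    exact ⟨opair η ζ, opair_mem_prod.2 ⟨hη, hκl.subs hlo _ (hval hζ)⟩, η, ζ, rfl, hζ⟩

/-! ### Bounds and clubs in the successor of a cardinal above a weakly LS cardinal -/

theorem IsSuccCard.isLimit {κ l μ : M} (h : IsWeaklyLS κ) (hκl : Le κ l) (hμ : IsSuccCard μ l) :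
    IsLimit μ :=
  h.isLimit_card hμ.1 (.inr (hκl.trans_mem hμ.1.1 hμ.2.1))

theorem union_mem {α β γ : M} (hγ : IsOrd γ) (hα : α ∈ₘ γ) (hβ : β ∈ₘ γ) : union α β ∈ₘ γ := by
  rcases union_eq_of_ord (hγ.mem hα) (hγ.mem hβ) with e | e <;> rw [e] <;> assumption

/-- A definable partial function from `x` to `μ` is bounded below `μ`. -/
theorem IsWeaklyLS.exists_bound {κ l μ x : M} (h : IsWeaklyLS κ) (hκl : Le κ l)
    (hμ : IsSuccCard μ l) (hx : x ∈ₘ V κ) (R : M → M → Prop)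
    [hRd : FO fun v : ℕ → M => R (v 0) (v 1)]
    (hR : ∀ a y y', a ∈ₘ x → R a y → R a y' → y = y') :
    ∃ β, β ∈ₘ μ ∧ ∀ a y, a ∈ₘ x → R a y → y ∈ₘ μ → y ∈ₘ β := by
  have hRd' := fun (t u : (ℕ → M) → M) [DF t] [DF u] => FO.subst₂ hRd (t := t) (u := u)
  have hμo := hμ.1.1
  have hlim := hμ.isLimit h hκl
  by_contra hc
  push Not at hc
  -- For each `a` the hull contains some partial function from `l` covering the ordinal `R` assigns
  -- to `a`. With `k` indexing the hull by `T`, the map `(t, η) ↦ k(t)(η)` takes every value below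
  -- `μ`, since these ordinals are unbounded.
  obtain ⟨X, T, hT, ⟨k, hk, hkX⟩, hxX, -, hcl⟩ := h.exists_hull hx x (pow (prod l μ))
    (fun a _ g => (∀ η z z', Val g η z → Val g η z' → z = z') ∧
      ∃ y, R a y ∧ ∀ z, z ∈ₘ y → ∃ η, η ∈ₘ l ∧ Val g η z)
  refine h.not_onto_prod hκl hμ hT (Onto.of_rel (fun p ξ => ∃ t η g, p = opair t η ∧ Val k t g ∧
    (∀ η z z', Val g η z → Val g η z' → z = z') ∧ Val g η ξ) ?_ fun ξ hξ => ?_)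
  · rintro p ξ ξ' - ⟨t, η, g, rfl, h1, h2, h3⟩ ⟨t', η', g', e, h1', -, h3'⟩
    obtain ⟨rfl, rfl⟩ := opair_inj.1 e
    obtain rfl := hk _ _ _ h1 h1'
    exact h2 _ _ _ h3 h3'
  · obtain ⟨a, y, ha, hy, hyμ, hyξ⟩ := hc _ (hlim.2 ξ hξ)
    have hξy : ξ ∈ₘ y := by
      rcases (hμo.mem hξ).succ.le_or_mem (hμo.mem hyμ) with hle | hm
      exacts [hle.subs (hμo.mem hyμ) _ (mem_succ_self ξ), (hyξ hm).elim]
    obtain ⟨f, hf, hfs⟩ := hμ.onto hyμ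
    -- `Onto` permits stray arguments and values; trimming puts the function into `pow (prod l μ)`.
    obtain ⟨g, hg⟩ := sep (prod l μ) (fun p => p ∈ₘ f)
    have hgv : ∀ η z, Val g η z ↔ (η ∈ₘ l ∧ z ∈ₘ μ) ∧ Val f η z := fun η z => by
      rw [val_iff, hg, opair_mem_prod, ← val_iff]
    obtain ⟨g', hg'X, -, hg'f, y', hy', hs⟩ := hcl a a (hxX a ha) (hxX a ha) ha ha
      ⟨g, mem_pow.2 fun p hp => ((hg p).1 hp).1,
        fun η z z' hz hz' => hf _ _ _ ((hgv _ _).1 hz).2 ((hgv _ _).1 hz').2, y, hy,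
        fun z hz => by
          obtain ⟨η, hη, hv⟩ := hfs z hz
          exact ⟨η, hη, (hgv η z).2 ⟨⟨hη, hμo.trans hyμ hz⟩, hv⟩⟩⟩
    obtain rfl := hR a y y' ha hy hy'
    obtain ⟨η, hη, hv⟩ := hs ξ hξy
    obtain ⟨t, ht, htg⟩ := hkX g' hg'X
    exact ⟨opair t η, opair_mem_prod.2 ⟨ht, hη⟩, t, η, g', rfl, htg, hg'f, hv⟩

theorem IsCofinalMap.false_of_bound {f x μ β : M} (hμ : IsOrd μ) (hf : IsCofinalMap f x μ)
    (hβ : β ∈ₘ μ) (h : ∀ a y, a ∈ₘ x → Val f a y → y ∈ₘ μ → y ∈ₘ β) : False := by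
  obtain ⟨a, y, hv, hle⟩ := hf.2 β hβ
  have hy := hf.1.2 a y hv
  exact not_mem_of_le (hμ.mem hy) hle (h a y (hf.1.1.mem_dom hv) hv hy)

theorem IsWeaklyLS.not_isCofinalMap {κ l μ x f : M} (h : IsWeaklyLS κ) (hκl : Le κ l)
    (hμ : IsSuccCard μ l) (hx : x ∈ₘ V κ) : ¬ IsCofinalMap f x μ := by
  intro hf
  obtain ⟨β, hβ, hb⟩ := h.exists_bound hκl hμ hx (Val f) fun _ _ _ _ => hf.1.1.unique
  exact hf.false_of_bound hμ.1.1 hβ hb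

theorem exists_id_cofinal (α : M) : ∃ f, IsCofinalMap f α α := by
  obtain ⟨f, hf, hv⟩ := exists_fun α (fun x y => x = y) (fun x _ => ⟨x, rfl⟩)
    (by rintro x - y y' rfl rfl; rfl)
  refine ⟨f, ⟨hf, fun x y h => ?_⟩, fun β hβ => ⟨β, β, (hv β β).2 ⟨hβ, rfl⟩, .inl rfl⟩⟩
  obtain ⟨hx, rfl⟩ := (hv x y).1 h
  exact hx

theorem exists_isCof {α : M} (hα : IsOrd α) : ∃ c, IsCof c α := by
  obtain ⟨c, hc, hf, -, hm⟩ := ord_min (fun c => ∃ f, IsCofinalMap f c α) hα (exists_id_cofinal α)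
  exact ⟨c, hc, hf, hm⟩

theorem IsWeaklyLS.exists_isCof {κ l μ : M} (h : IsWeaklyLS κ) (hκl : Le κ l)
    (hμ : IsSuccCard μ l) : ∃ c, IsCof c μ ∧ Le κ c := by
  obtain ⟨c, hc⟩ := ChoicelessLS.exists_isCof hμ.1.1
  refine ⟨c, hc, (h.isOrd.le_or_mem hc.1).resolve_right fun hcκ => ?_⟩
  obtain ⟨f, hf⟩ := hc.2.1
  exact h.not_isCofinalMap hκl hμ (mem_V_of_mem h.isOrd hcκ) hf

/-- The supremum of the ordinals below `μ` in a small set is below `μ`. -/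
theorem IsWeaklyLS.exists_sup {κ l μ T X : M} (h : IsWeaklyLS κ) (hκl : Le κ l)
    (hμ : IsSuccCard μ l) (hT : T ∈ₘ V κ) (hTX : Onto T X) :
    ∃ δ, δ ∈ₘ μ ∧ ∀ z, z ∈ₘ δ ↔ ∃ a, a ∈ₘ X ∧ a ∈ₘ μ ∧ z ∈ₘ a := by
  have hμo := hμ.1.1
  obtain ⟨k, hk, hkX⟩ := hTX
  obtain ⟨β, hβ, hb⟩ := h.exists_bound hκl hμ hT (Val k) fun _ _ _ _ => hk _ _ _
  obtain ⟨Y, hY⟩ := sep X (fun a => a ∈ₘ μ)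
  have hsup : ∀ z, z ∈ₘ sUnion Y ↔ ∃ a, a ∈ₘ X ∧ a ∈ₘ μ ∧ z ∈ₘ a := fun z => by
    simp only [mem_sUnion, hY, and_assoc]
  refine ⟨sUnion Y, Le.trans_mem hμo (le_of_subs (isOrd_sUnion fun y hy =>
    hμo.mem ((hY y).1 hy).2) (hμo.mem hβ) fun z hz => ?_) hβ, hsup⟩
  obtain ⟨a, haX, haμ, hza⟩ := (hsup z).1 hz
  obtain ⟨t, ht, hv⟩ := hkX a haX
  exact (hμo.mem hβ).trans (hb t a ht hv haμ) hza

theorem emp_mem_V {κ : M} (h : IsWeaklyLS κ) : emp M ∈ₘ V κ :=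
  mem_V_of_mem h.isOrd (h.isOrd.trans h.om_mem emp_mem_om)

/-- A small family of clubs has a club below all its members. -/
theorem IsWeaklyLS.exists_club {κ l μ T Y : M} (h : IsWeaklyLS κ) (hκl : Le κ l)
    (hμ : IsSuccCard μ l) (hT : T ∈ₘ V κ) (hTY : Onto T Y) (hY : ∀ C, C ∈ₘ Y → IsClubIn C μ) :
    ∃ D, IsClubIn D μ ∧ ∀ C, C ∈ₘ Y → Subs D C := by
  have hμo := hμ.1.1
  have hlim := hμ.isLimit h hκl
  obtain ⟨D, hD⟩ := sep μ (fun ξ => ∀ C, C ∈ₘ Y → ξ ∈ₘ C)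
  refine ⟨D, ⟨fun ξ hξ => ((hD ξ).1 hξ).1, fun β hβ => ?_, fun δ hδ hδ0 hlimδ => ?_⟩,
    fun C hC ξ hξ => ((hD ξ).1 hξ).2 C hC⟩
  · have next : ∀ β, β ∈ₘ μ → ∃ γ, γ ∈ₘ μ ∧ β ∈ₘ γ ∧
        ∀ C, C ∈ₘ Y → ∃ ξ, ξ ∈ₘ C ∧ β ∈ₘ ξ ∧ ξ ∈ₘ γ := by
      intro β hβ
      obtain ⟨k, hk, hkY⟩ := hTY
      obtain ⟨γ, hγ, hb⟩ := h.exists_bound hκl hμ hT (fun t ξ => ∃ C, Val k t C ∧ C ∈ₘ Y ∧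
        (ξ ∈ₘ C ∧ β ∈ₘ ξ) ∧ ∀ ξ', ξ' ∈ₘ ξ → ¬ (ξ' ∈ₘ C ∧ β ∈ₘ ξ')) (by
        rintro t ξ ξ' - ⟨C, h1, hC, h2, h3⟩ ⟨C', h1', -, h2', h3'⟩
        obtain rfl := hk _ _ _ h1 h1'
        rcases (hμo.mem ((hY C hC).1 ξ h2.1)).trichotomy (hμo.mem ((hY C hC).1 ξ' h2'.1))
          with h | h | h
        exacts [(h3' _ h h2).elim, h, (h3 _ h h2').elim])
      refine ⟨union γ (succ β), union_mem hμo hγ (hlim.2 β hβ),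
        mem_union.2 (.inr (mem_succ_self β)), fun C hC => ?_⟩
      obtain ⟨ξ₀, hξ₀, hβξ₀⟩ := (hY C hC).2.1 β hβ
      obtain ⟨ξ, -, hξ, -, hm⟩ := ord_min (fun ξ => ξ ∈ₘ C ∧ β ∈ₘ ξ)
        (hμo.mem ((hY C hC).1 ξ₀ hξ₀)) ⟨hξ₀, hβξ₀⟩
      obtain ⟨t, ht, hv⟩ := hkY C hC
      exact ⟨ξ, hξ.1, hξ.2, mem_union.2 (.inl (hb t ξ ht ⟨C, hv, hC, hξ, hm⟩
        ((hY C hC).1 ξ hξ.1)))⟩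
    -- The hull is built over `{0}` since `β` need not lie in `V κ`. The relation sends `0` to `succ
    -- β`, which starts the climb above `β`, and any other `a` to a bound supplied by `next`. The
    -- supremum of the climb is a limit of every club of the family.
    have h1V : upair (emp M) (emp M) ∈ₘ V κ := h.isLimit.upair (emp_mem_V h) (emp_mem_V h)
    obtain ⟨X, T', hT', hTX, h0X, -, hcl⟩ := h.exists_hull h1V μ μ
      (fun a _ c => (a = emp M ∧ c = succ β) ∨ (a ≠ emp M ∧ a ∈ₘ c ∧
        ∀ C, C ∈ₘ Y → ∃ ξ, ξ ∈ₘ C ∧ a ∈ₘ ξ ∧ ξ ∈ₘ c))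
    obtain ⟨δ, hδμ, hδ⟩ := h.exists_sup hκl hμ hT' hTX
    have h0 : emp M ∈ₘ X := h0X _ (mem_upair.2 (.inl rfl))
    have h0μ : emp M ∈ₘ μ := emp_mem hμo fun e => not_mem_emp (e ▸ hβ)
    have hβδ : β ∈ₘ δ := by
      obtain ⟨c, hcX, hcμ, ⟨-, rfl⟩ | ⟨hne, -⟩⟩ := hcl _ _ h0 h0 h0μ h0μ
        ⟨succ β, hlim.2 β hβ, .inl ⟨rfl, rfl⟩⟩
      exacts [(hδ β).2 ⟨_, hcX, hcμ, mem_succ_self β⟩, (hne rfl).elim]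
    refine ⟨δ, (hD δ).2 ⟨hδμ, fun C hC => ?_⟩, hβδ⟩
    refine (hY C hC).2.2 δ hδμ (fun h => h β hβδ) fun z hz => ?_
    obtain ⟨a, haX, haμ, hza⟩ := (hδ z).1 hz
    have ha0 : a ≠ emp M := fun e => not_mem_emp (e ▸ hza)
    obtain ⟨γ, hγ, h1, h2⟩ := next a haμ
    obtain ⟨c, hcX, hcμ, ⟨e, -⟩ | ⟨-, hac, hc⟩⟩ := hcl a a haX haX haμ haμ
      ⟨γ, hγ, .inr ⟨ha0, h1, h2⟩⟩
    · exact (ha0 e).elim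
    · obtain ⟨ξ, hξC, haξ, hξc⟩ := hc C hC
      exact ⟨ξ, hξC, (hδ ξ).2 ⟨c, hcX, hcμ, hξc⟩,
        (hμo.mem ((hY C hC).1 ξ hξC)).trans haξ hza⟩
  · refine (hD δ).2 ⟨hδ, fun C hC => (hY C hC).2.2 δ hδ hδ0 fun β hβ => ?_⟩
    obtain ⟨ξ, hξ, h1, h2⟩ := hlimδ β hβ
    exact ⟨ξ, ((hD ξ).1 hξ).2 C hC, h1, h2⟩

/-- A small definable family of members of the club filter has a common club. -/
theorem IsWeaklyLS.inter_club {κ l μ x : M} (h : IsWeaklyLS κ) (hκl : Le κ l)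
    (hμ : IsSuccCard μ l) (hx : x ∈ₘ V κ) (R : M → M → Prop)
    [hRd : FO fun v : ℕ → M => R (v 0) (v 1)]
    (hR : ∀ a y y', a ∈ₘ x → R a y → R a y' → y = y')
    (hRμ : ∀ a S, a ∈ₘ x → R a S → InClubFilter S μ) :
    ∃ C, IsClubIn C μ ∧ ∀ a S, a ∈ₘ x → R a S → Subs C S := by
  have hRd' := fun (t u : (ℕ → M) → M) [DF t] [DF u] => FO.subst₂ hRd (t := t) (u := u)
  -- No club is selected for any `a`: the hull contains at least one suitable club for each, and all
  -- clubs in it are intersected.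
  obtain ⟨X, T, hT, hTX, hxX, -, hcl⟩ := h.exists_hull hx x (pow μ)
    (fun a _ C => IsClubIn C μ ∧ ∃ S, R a S ∧ Subs C S)
  obtain ⟨Y, hY⟩ := sep X (fun C => IsClubIn C μ)
  obtain ⟨D, hD, hDY⟩ := h.exists_club hκl hμ hT
    (hTX.mono (Subs.refl _) fun C hC => ((hY C).1 hC).1) fun C hC => ((hY C).1 hC).2
  refine ⟨D, hD, fun a S ha hS => ?_⟩
  obtain ⟨-, C, hC, hCS⟩ := hRμ a S ha hS
  obtain ⟨C', hC'X, -, hC', S', hS', hCS'⟩ := hcl a a (hxX a ha) (hxX a ha) ha ha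
    ⟨C, mem_pow.2 hC.1, hC, S, hS, hCS⟩
  obtain rfl := hR a S S' ha hS hS'
  exact (hDY C' ((hY C').2 ⟨hC'X, hC'⟩)).trans hCS'

theorem InterContainsClub.exists_inter {f μ : M} (h : InterContainsClub f μ) :
    ∃ D, (∀ ξ, ξ ∈ₘ D ↔ ξ ∈ₘ μ ∧ ∀ a S, Val f a S → ξ ∈ₘ S) ∧ InClubFilter D μ := by
  obtain ⟨C, hC, hCS⟩ := h
  obtain ⟨D, hD⟩ := sep μ (fun ξ => ∀ a S, Val f a S → ξ ∈ₘ S)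
  exact ⟨D, hD, fun ξ hξ => ((hD ξ).1 hξ).1, C, hC, fun ξ hξ => (hD ξ).2
    ⟨hC.1 ξ hξ, fun a S hS => hCS a S hS ξ hξ⟩⟩

theorem IsWeaklyLS.interContainsClub {κ l μ x f : M} (h : IsWeaklyLS κ) (hκl : Le κ l)
    (hμ : IsSuccCard μ l) (hx : x ∈ₘ V κ) (hf : IsFunIntoClubFilter f x μ) :
    InterContainsClub f μ := by
  obtain ⟨C, hC, hCS⟩ := h.inter_club hκl hμ hx (Val f) (fun _ _ _ _ => hf.1.unique)
    fun a S _ => hf.2 a S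
  exact ⟨C, hC, fun a S hS => hCS a S (hf.1.mem_dom hS) hS⟩

theorem IsWeaklyLS.clubFilterComplete {κ l μ : M} (h : IsWeaklyLS κ) (hκl : Le κ l)
    (hμ : IsSuccCard μ l) : ClubFilterComplete κ μ := fun _ _ hδ hf =>
  (h.interContainsClub hκl hμ (mem_V_of_mem h.isOrd hδ) hf).exists_inter

theorem exists_club_of_not_stationary {S μ : M} (hS : Subs S μ) (h : ¬ IsStationaryIn S μ) :
    ∃ C, IsClubIn C μ ∧ ∀ ξ, ξ ∈ₘ C → ¬ ξ ∈ₘ S := by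
  by_contra hc
  push Not at hc
  exact h ⟨hS, hc⟩

theorem IsRegressive.mem {f μ ξ η : M} (hf : IsRegressive f μ) (h : Val f ξ η) :
    ξ ∈ₘ μ ∧ η ∈ₘ μ := by
  obtain ⟨⟨d, hd, hfd⟩, -⟩ := hf
  exact ⟨((hd ξ).1 (hfd.1.mem_dom h)).1, hfd.2 ξ η h⟩

/-- A weak form of Fodor's lemma. -/
theorem IsWeaklyLS.exists_stationary_le {κ l μ f : M} (h : IsWeaklyLS κ) (hκl : Le κ l)
    (hμ : IsSuccCard μ l) (hf : IsRegressive f μ) : ∃ γ, γ ∈ₘ μ ∧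
      ∃ S, (∀ ξ, ξ ∈ₘ S ↔ ∃ η, Val f ξ η ∧ Le η γ) ∧ IsStationaryIn S μ := by
  have hμo := hμ.1.1
  by_contra hc
  push Not at hc
  have hclub : ∀ γ, γ ∈ₘ μ → ∃ C, IsClubIn C μ ∧ ∀ ξ, ξ ∈ₘ C → ∀ η, Val f ξ η → ¬ Le η γ := by
    intro γ hγ
    obtain ⟨S, hS⟩ := sep μ (fun ξ => ∃ η, Val f ξ η ∧ Le η γ)
    obtain ⟨C, hC, hCS⟩ := exists_club_of_not_stationary (fun ξ hξ => ((hS ξ).1 hξ).1)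
      (hc γ hγ S fun ξ => (hS ξ).trans ⟨fun h => h.2, fun h =>
        ⟨(hf.mem h.choose_spec.1).1, h⟩⟩)
    exact ⟨C, hC, fun ξ hξ η hη hle => hCS ξ hξ ((hS ξ).2 ⟨hC.1 ξ hξ, η, hη, hle⟩)⟩
  -- Clubs are never ordinals below `μ`, so the two clauses of the relation below cannot be
  -- confused.
  have hnot : ∀ C, IsClubIn C μ → ¬ C ∈ₘ μ := by
    intro C hC hCμ
    obtain ⟨ξ, hξ, hCξ⟩ := hC.2.1 C hCμ
    exact mem_asymm hξ hCξ
  have h1V : upair (emp M) (emp M) ∈ₘ V κ := h.isLimit.upair (emp_mem_V h) (emp_mem_V h)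
  -- One relation encodes two closure conditions: an ordinal `a`, fed in twice, yields a club
  -- avoiding `{ξ | f(ξ) ≤ a}`, and a club with an ordinal yields a larger point of the club. Then
  -- `δ`, the supremum of the hull's ordinals below `μ`, lies in each of the hull's clubs, while
  -- `f(δ) < a` for some `a` in the hull.
  obtain ⟨X, T, hT, hTX, h0X, -, hcl⟩ := h.exists_hull h1V (union μ (pow μ)) (union μ (pow μ))
    (fun a b c => (a = b ∧ a ∈ₘ μ ∧ IsClubIn c μ ∧ ∀ ξ, ξ ∈ₘ c → ∀ η, Val f ξ η → ¬ Le η a) ∨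
      (IsClubIn a μ ∧ b ∈ₘ μ ∧ c ∈ₘ a ∧ b ∈ₘ c))
  obtain ⟨δ, hδμ, hδ⟩ := h.exists_sup hκl hμ hT hTX
  have h0 : emp M ∈ₘ X := h0X _ (mem_upair.2 (.inl rfl))
  have h0μ : emp M ∈ₘ μ := emp_mem hμo fun e => not_mem_emp (e ▸ hδμ)
  have hl : ∀ {a}, a ∈ₘ μ → a ∈ₘ union μ (pow μ) := fun h => mem_union.2 (.inl h)
  have hr : ∀ {C}, IsClubIn C μ → C ∈ₘ union μ (pow μ) := fun h => mem_union.2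
    (.inr (mem_pow.2 h.1))
  have hC : ∀ a, a ∈ₘ X → a ∈ₘ μ → ∃ C, C ∈ₘ X ∧ IsClubIn C μ ∧
      ∀ ξ, ξ ∈ₘ C → ∀ η, Val f ξ η → ¬ Le η a := by
    intro a haX haμ
    obtain ⟨C, hC, hCf⟩ := hclub a haμ
    obtain ⟨C', hC'X, -, ⟨-, -, hC'⟩ | ⟨ha, -⟩⟩ := hcl a a haX haX (hl haμ) (hl haμ)
      ⟨C, hr hC, .inl ⟨rfl, haμ, hC, hCf⟩⟩
    exacts [⟨C', hC'X, hC'⟩, (hnot a ha haμ).elim]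
  have hnext : ∀ C a, C ∈ₘ X → IsClubIn C μ → a ∈ₘ X → a ∈ₘ μ → ∃ c, c ∈ₘ X ∧ c ∈ₘ C ∧ a ∈ₘ c := by
    intro C a hCX hC haX haμ
    obtain ⟨ξ, hξ, haξ⟩ := hC.2.1 a haμ
    obtain ⟨c, hcX, -, ⟨-, hCμ, -⟩ | ⟨-, -, hcC, hac⟩⟩ := hcl C a hCX haX (hr hC) (hl haμ)
      ⟨ξ, hl (hC.1 ξ hξ), .inr ⟨hC, haμ, hξ, haξ⟩⟩
    exacts [(hnot C hC hCμ).elim, ⟨c, hcX, hcC, hac⟩]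
  have hXδ : ∀ a, a ∈ₘ X → a ∈ₘ μ → a ∈ₘ δ := by
    intro a haX haμ
    obtain ⟨C, hCX, hC, -⟩ := hC a haX haμ
    obtain ⟨c, hcX, hcC, hac⟩ := hnext C a hCX hC haX haμ
    exact (hδ a).2 ⟨c, hcX, hC.1 c hcC, hac⟩
  have hδ0 : ¬ IsEmptySet δ := fun h => h _ (hXδ _ h0 h0μ)
  have hδC : ∀ C, C ∈ₘ X → IsClubIn C μ → δ ∈ₘ C := by
    intro C hCX hC
    refine hC.2.2 δ hδμ hδ0 fun β hβ => ?_
    obtain ⟨a, haX, haμ, hβa⟩ := (hδ β).1 hβ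
    obtain ⟨c, hcX, hcC, hac⟩ := hnext C a hCX hC haX haμ
    have hcμ := hC.1 c hcC
    exact ⟨c, hcC, hXδ c hcX hcμ, (hμo.mem hcμ).trans hac hβa⟩
  obtain ⟨⟨d, hd, hfd⟩, hreg⟩ := hf
  obtain ⟨η, hη⟩ := hfd.1.exists_val ((hd δ).2 ⟨hδμ, hδ0⟩)
  obtain ⟨a, haX, haμ, hηa⟩ := (hδ η).1 (hreg δ η hη)
  obtain ⟨C, hCX, hC, hCf⟩ := hC a haX haμ
  exact hCf δ (hδC C hCX hC) η hη (.inr hηa)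

/-! ### Singular weakly LS cardinals -/

/-- Singularity presents `V l` as a union of members of `V l` indexed by `cf(l)`, so results for
index sets in `V l` extend to `V l` in two stages. -/
theorem exists_cofinal_hierarchy {l : M} (h : IsWeaklyLS l) (hs : IsSingularCard l) :
    ∃ c g, c ∈ₘ V l ∧ IsFun g c ∧ (∀ i y, Val g i y → V (succ y) ∈ₘ V l) ∧
      ∀ v, v ∈ₘ V l → ∃ i y, Val g i y ∧ v ∈ₘ V (succ y) := by
  obtain ⟨-, c, ⟨-, ⟨g, hg⟩, -⟩, hcl⟩ := hs
  refine ⟨c, g, mem_V_of_mem h.isOrd hcl, hg.1.1, fun i y hv => ?_, fun v hv => ?_⟩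
  · exact (mem_V h.isOrd).2 ⟨succ y, h.isLimit.2 y (hg.1.2 i y hv), Subs.refl _⟩
  · obtain ⟨β, hβ, hvβ⟩ := (mem_V h.isOrd).1 hv
    obtain ⟨i, y, hi, hle⟩ := hg.2 β hβ
    have hyo := h.isOrd.mem (hg.1.2 i y hi)
    exact ⟨i, y, hi, (mem_V_succ hyo).2
      (hvβ.trans (V_mono (h.isOrd.mem hβ) hyo (hle.subs hyo)))⟩

theorem exists_bound_V {l μ : M} (h : IsWeaklyLS l) (hs : IsSingularCard l)
    (hμ : IsSuccCard μ l) (R : M → M → Prop) [hRd : FO fun v : ℕ → M => R (v 0) (v 1)]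
    (hR : ∀ a y y', R a y → R a y' → y = y') :
    ∃ β, β ∈ₘ μ ∧ ∀ a y, a ∈ₘ V l → R a y → y ∈ₘ μ → y ∈ₘ β := by
  have hRd' := fun (t u : (ℕ → M) → M) [DF t] [DF u] => FO.subst₂ hRd (t := t) (u := u)
  have hμo := hμ.1.1
  obtain ⟨c, g, hc, hg, hgV, hcov⟩ := exists_cofinal_hierarchy h hs
  -- Second stage: each index is sent to the least bound for its level, leastness making the
  -- relation functional. That such bounds exist is the first stage, applied further on.
  obtain ⟨β, hβ, hb⟩ := h.exists_bound (.inl rfl) hμ hc (fun i γ => ∃ x, Val g i x ∧ γ ∈ₘ μ ∧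
    (∀ a y, a ∈ₘ V (succ x) → R a y → y ∈ₘ μ → y ∈ₘ γ) ∧
    ∀ γ', γ' ∈ₘ γ → ¬ ∀ a y, a ∈ₘ V (succ x) → R a y → y ∈ₘ μ → y ∈ₘ γ') (by
    rintro i γ γ' - ⟨x, hx, h1, h2, h3⟩ ⟨x', hx', h1', h2', h3'⟩
    obtain rfl := hg.unique hx hx'
    rcases (hμo.mem h1).trichotomy (hμo.mem h1') with h | h | h
    exacts [(h3' _ h h2).elim, h, (h3 _ h h2').elim])
  refine ⟨β, hβ, fun a y ha hay hy => ?_⟩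
  obtain ⟨i, x, hi, hax⟩ := hcov a ha
  obtain ⟨γ₀, hγ₀, hb₀⟩ := h.exists_bound (.inl rfl) hμ (hgV i x hi) R fun a y y' _ => hR a y y'
  obtain ⟨γ, -, h1, hle, h2⟩ := ord_min
    (fun γ => ∀ a y, a ∈ₘ V (succ x) → R a y → y ∈ₘ μ → y ∈ₘ γ) (hμo.mem hγ₀) hb₀
  have hγμ : γ ∈ₘ μ := hle.trans_mem hμo hγ₀
  exact (hμo.mem hβ).trans (hb i γ (hg.mem_dom hi) ⟨x, hi, hγμ, h1, h2⟩ hγμ) (h1 a y hax hay hy)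

/-- An ordinal `d < μ` is an image of `l ⊆ V l`, so a cofinal map from `d` would give a definable
unbounded map from `V l`. -/
theorem isRegularCard_succ {l μ : M} (h : IsWeaklyLS l) (hs : IsSingularCard l)
    (hμ : IsSuccCard μ l) : IsRegularCard μ := by
  refine ⟨⟨hμ.1, om M, isOmega_om, .inr (hμ.1.1.trans hμ.2.1 h.om_mem)⟩, hμ.1.1,
    exists_id_cofinal μ, ?_⟩
  rintro d hd ⟨f, hf⟩
  obtain ⟨k, hk, hks⟩ := hμ.onto hd
  obtain ⟨β, hβ, hb⟩ := exists_bound_V h hs hμ (fun a y => ∃ e, Val k a e ∧ Val f e y) (by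
    rintro a y y' ⟨e, h1, h2⟩ ⟨e', h1', h2'⟩
    obtain rfl := hk _ _ _ h1 h1'
    exact hf.1.1.unique h2 h2')
  refine hf.false_of_bound hμ.1.1 hβ fun e y he hy hyμ => ?_
  obtain ⟨a, ha, hae⟩ := hks e he
  exact hb a y (subs_V h.isOrd a ha) ⟨e, hae, hy⟩ hyμ

/-- Intersecting within one level stays in the club filter; these intersections, indexed by `cf(l)`,
are then intersected again. -/
theorem inter_club_V {l μ : M} (h : IsWeaklyLS l) (hs : IsSingularCard l)
    (hμ : IsSuccCard μ l) (R : M → M → Prop) [hRd : FO fun v : ℕ → M => R (v 0) (v 1)]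
    (hR : ∀ a y y', R a y → R a y' → y = y') (hRμ : ∀ a S, R a S → InClubFilter S μ) :
    ∃ C, IsClubIn C μ ∧ ∀ a S, a ∈ₘ V l → R a S → Subs C S := by
  have hRd' := fun (t u : (ℕ → M) → M) [DF t] [DF u] => FO.subst₂ hRd (t := t) (u := u)
  obtain ⟨c, g, hc, hg, hgV, hcov⟩ := exists_cofinal_hierarchy h hs
  obtain ⟨C, hC, hCS⟩ := h.inter_club (.inl rfl) hμ hc (fun i S => ∃ x, Val g i x ∧
    ∀ ξ, ξ ∈ₘ S ↔ ξ ∈ₘ μ ∧ ∀ a S', a ∈ₘ V (succ x) → R a S' → ξ ∈ₘ S') (by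
    rintro i S S' - ⟨x, hx, h1⟩ ⟨x', hx', h1'⟩
    obtain rfl := hg.unique hx hx'
    exact ext fun ξ => (h1 ξ).trans (h1' ξ).symm) (by
    rintro i S - ⟨x, hx, h1⟩
    obtain ⟨C, hC, hCS⟩ := h.inter_club (.inl rfl) hμ (hgV i x hx) R (fun a y y' _ => hR a y y')
      fun a S _ => hRμ a S
    exact ⟨fun ξ hξ => ((h1 ξ).1 hξ).1, C, hC, fun ξ hξ => (h1 ξ).2
      ⟨hC.1 ξ hξ, fun a S' ha hS' => hCS a S' ha hS' ξ hξ⟩⟩)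
  refine ⟨C, hC, fun a S ha hS ξ hξ => ?_⟩
  obtain ⟨i, x, hi, hax⟩ := hcov a ha
  obtain ⟨I, hI⟩ := sep μ (fun ξ => ∀ a S', a ∈ₘ V (succ x) → R a S' → ξ ∈ₘ S')
  exact ((hI ξ).1 (hCS i I (hg.mem_dom hi) ⟨x, hi, hI⟩ ξ hξ)).2 a S hax hS

theorem clubFilterComplete_succ {l μ : M} (h : IsWeaklyLS l) (hs : IsSingularCard l)
    (hμ : IsSuccCard μ l) : ClubFilterComplete μ μ := by
  intro δ f hδ hf
  obtain ⟨k, hk, hks⟩ := hμ.onto hδ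
  obtain ⟨C, hC, hCS⟩ := inter_club_V h hs hμ (fun a S => ∃ e, Val k a e ∧ Val f e S) (by
    rintro a S S' ⟨e, h1, h2⟩ ⟨e', h1', h2'⟩
    obtain rfl := hk _ _ _ h1 h1'
    exact hf.1.unique h2 h2') (by
    rintro a S ⟨e, -, hS⟩
    exact hf.2 e S hS)
  refine InterContainsClub.exists_inter ⟨C, hC, fun e S hS => ?_⟩
  obtain ⟨a, ha, hae⟩ := hks e (hf.1.mem_dom hS)
  exact hCS a S (subs_V h.isOrd a ha) ⟨e, hae, hS⟩

/-- Fodor's lemma at the successor of a singular weakly LS cardinal. -/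
theorem exists_stationary_eq {l μ f : M} (h : IsWeaklyLS l) (hs : IsSingularCard l)
    (hμ : IsSuccCard μ l) (hf : IsRegressive f μ) : ∃ γ, γ ∈ₘ μ ∧
      ∃ S, (∀ ξ, ξ ∈ₘ S ↔ Val f ξ γ) ∧ IsStationaryIn S μ := by
  obtain ⟨γ, hγ, S, hS, -, hst⟩ := h.exists_stationary_le (.inl rfl) hμ hf
  by_contra hc
  push Not at hc
  -- The successor is taken because the weak form bounds `f` by `γ` inclusively. If all fibres over
  -- `η ≤ γ` were nonstationary, their complements, indexed by `l` through `k`, would share a club,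
  -- which meets `S` all the same.
  obtain ⟨k, hk, hks⟩ := hμ.onto ((hμ.isLimit h (.inl rfl)).2 γ hγ)
  obtain ⟨C, hC, hCS⟩ := inter_club_V h hs hμ
    (fun a S => ∃ η, Val k a η ∧ η ∈ₘ μ ∧ ∀ ξ, ξ ∈ₘ S ↔ ξ ∈ₘ μ ∧ ¬ Val f ξ η) (by
    rintro a S S' ⟨η, h1, -, h2⟩ ⟨η', h1', -, h2'⟩
    obtain rfl := hk _ _ _ h1 h1'
    exact ext fun ξ => (h2 ξ).trans (h2' ξ).symm) (by
    rintro a S ⟨η, -, hη, h2⟩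
    obtain ⟨N, hN⟩ := sep μ (fun ξ => Val f ξ η)
    obtain ⟨C, hC, hCN⟩ := exists_club_of_not_stationary (fun ξ hξ => ((hN ξ).1 hξ).1)
      (hc η hη N fun ξ => (hN ξ).trans ⟨fun h => h.2, fun h => ⟨(hf.mem h).1, h⟩⟩)
    exact ⟨fun ξ hξ => ((h2 ξ).1 hξ).1, C, hC, fun ξ hξ => (h2 ξ).2 ⟨hC.1 ξ hξ, fun hv =>
      hCN ξ hξ ((hN ξ).2 ⟨hC.1 ξ hξ, hv⟩)⟩⟩)
  obtain ⟨ξ, hξC, hξS⟩ := hst C hC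
  obtain ⟨η, hη, hle⟩ := (hS ξ).1 hξS
  obtain ⟨a, ha, hae⟩ := hks η (mem_succ_iff_le.2 hle)
  obtain ⟨N, hN⟩ := sep μ (fun ξ => ¬ Val f ξ η)
  exact ((hN ξ).1 (hCS a N (subs_V h.isOrd a ha) ⟨η, hae, (hf.mem hη).2, hN⟩ ξ hξC)).2 hη

end ChoicelessLS

/-! ### The theorem -/

theorem mainTheorem11 {M : Type*} [setLang.Structure M] (hM : IsZFModel M) :
    (∀ κ Vκ : M, IsWeaklyLS κ → IsV κ Vκ →
      (∀ x, x ∈ₘ Vκ → ¬ ∃ f, IsSurj f x κ) ∧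
      ∀ l μ : M, IsCard l → Le κ l → IsSuccCard μ l →
        ((∀ x, x ∈ₘ Vκ → ¬ ∃ f, IsCofinalMap f x μ) ∧
          ∃ c, IsCof c μ ∧ Le κ c) ∧
        ((∀ x f, x ∈ₘ Vκ → IsFunIntoClubFilter f x μ → InterContainsClub f μ) ∧
          ClubFilterComplete κ μ) ∧
        (∀ f, IsRegressive f μ → ∃ γ, γ ∈ₘ μ ∧
          ∃ S, (∀ ξ, ξ ∈ₘ S ↔ ∃ η, Val f ξ η ∧ Le η γ) ∧ IsStationaryIn S μ)) ∧
    (∀ l Vl μ : M, IsWeaklyLS l → IsSingularCard l → IsV l Vl → IsSuccCard μ l →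
      ((¬ ∃ f, IsCofinalMap f Vl μ) ∧ IsRegularCard μ) ∧
      ((∀ f, IsFunIntoClubFilter f Vl μ → InterContainsClub f μ) ∧
        ClubFilterComplete μ μ) ∧
      (∀ f, IsRegressive f μ → ∃ γ, γ ∈ₘ μ ∧
        ∃ S, (∀ ξ, ξ ∈ₘ S ↔ Val f ξ γ) ∧ IsStationaryIn S μ)) := by
  have : ZF M := ⟨hM⟩
  refine ⟨fun κ Vκ h hV => ?_, fun l Vl μ h hs hV hμ => ?_⟩
  · obtain rfl := (isV_iff h.isOrd).1 hV
    refine ⟨fun x hx ⟨f, hf⟩ => h.not_onto hx hf.onto, fun l μ _ hκl hμ => ⟨⟨?_, ?_⟩, ⟨?_, ?_⟩, ?_⟩⟩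
    · exact fun x hx ⟨f, hf⟩ => h.not_isCofinalMap hκl hμ hx hf
    · exact h.exists_isCof hκl hμ
    · exact fun x f hx hf => h.interContainsClub hκl hμ hx hf
    · exact h.clubFilterComplete hκl hμ
    · exact fun f hf => h.exists_stationary_le hκl hμ hf
  · obtain rfl := (isV_iff h.isOrd).1 hV
    refine ⟨⟨?_, isRegularCard_succ h hs hμ⟩, ⟨fun f hf => ?_, clubFilterComplete_succ h hs hμ⟩,
      fun f hf => exists_stationary_eq h hs hμ hf⟩
    · rintro ⟨f, hf⟩
      obtain ⟨β, hβ, hb⟩ := exists_bound_V h hs hμ (Val f) fun _ _ _ => hf.1.1.unique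
      exact hf.false_of_bound hμ.1.1 hβ hb
    · obtain ⟨C, hC, hCS⟩ := inter_club_V h hs hμ (Val f) (fun _ _ _ => hf.1.unique) hf.2
      exact ⟨C, hC, fun a S hS => hCS a S (hf.1.mem_dom hS) hS⟩
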